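/- Let $a<b$, $T>0$, $\gamma\in(0,1)$, $\lambda\ge 0$, $K_\gamma>0$, $p\in\mathbb C$ with $\operatorname{Re}p\ge 0$, $U\ge 0$ a real function on $[a,b]$, and $f$ a complex-valued source term. For $v\in C^1[0,T]$ let ${}_0^CD_t^\gamma v(t)=\frac1{\Gamma(1-\gamma)}\int_0^t(t-\xi)^{-\gamma}v'(\xi)\,d\xi$ be the Caputo derivative. Let $G(x,t)$, of class $C^1$ in $t\in[0,T]$, be an exact solution of $$e^{-(\lambda+pU(x))t}\,{}_0^CD_t^\gamma\!\left(e^{(\lambda+pU(x))t}G(x,t)\right)-\lambda^\gamma G(x,t)=K_\gamma\,\partial_x^2G(x,t)+f(x,t),\qquad x\in(a,b),\ t\in(0,T],$$ with $G(x,0)=0$ and $G(a,t)=G(b,t)=0$. Assume that $G$ is smooth in the following sense. * $G(\cdot,t)\in C^4[a,b]$ for every $t\in[0,T]$, and $\partial_x^4G$ is bounded on $[a,b]\times[0,T]$. * For every $x\in(a,b)$ the function $t\mapsto e^{(\lambda+pU(x))t}G(x,t)$ on $[0,T]$ has an extension $w_x\in L^1(\mathbb R)$ with $w_x(t)=0$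 for $t\le 0$, such that $\sup_{x\in(a,b)}\int_{\mathbb R}(1+|\omega|)^{1+\gamma}\,|\widehat{w_x}(\omega)|\,d\omega<\infty$, where $\widehat{w}(\omega)=\int_{\mathbb R}e^{-i\omega t}w(t)\,dt$. For integers $N,M\ge1$ put $\tau=T/N$, $h=(b-a)/M$, $t_n=n\tau$, $x_m=a+mh$. Let $(1-z)^\gamma=\sum_{k\ge0}g_k^{(\gamma)}z^k$, $d_0=1-e^{-\gamma\lambda\tau}(\lambda\tau)^\gamma$, and $d_k=e^{-k\lambda\tau}g_k^{(\gamma)}$ for $k\ge1$. Let $(G^n_m)_{0\le n\le N,\,0\le m\le M}$ be the solution of the finite difference scheme $$\frac1{\tau^\gamma}\sum_{k=0}^n d_k\,e^{-pU(x_m)k\tau}\,G^{n-k}_m=K_\gamma\,\frac{G^n_{m-1}-2G^n_m+G^n_{m+1}}{h^2}+f(x_m,t_n),\qquad 1\le n\le N,\ 1\le m\le M-1,$$ with $G^0_m=0$ and $G^n_0=G^n_M=0$, and let $E^n_m=G(x_m,t_n)-G^n_m$. Then $$|||E_h|||_{0',h,\infty}:=\sum_{n=1}^N\tau\max_{1\le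 m\le M-1}|E^n_m|<c_1(\tau+h^2),\qquad |||E_h|||_{0,h,1}:=\Big(\sum_{n=1}^N\tau\,h\sum_{m=1}^M\Big|\frac{E^n_m-E^n_{m-1}}{h}\Big|^2\Big)^{1/2}<c_2(\tau+h^2)$$ with constants $c_1,c_2$ that do not depend on $\tau$ and $h$ (an empty maximum is $0$). -/

import Mathlib

namespace TemperedFeynmanKac

open MeasureTheory Set

noncomputable section

/-! ### Fractional operators and the function class -/

/-- The Riemann-Liouville integral of order `α` with base point `0`. -/
def rlIntegral (α : ℝ) (v : ℝ → ℂ) (t : ℝ) : ℂ :=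
  ((1 / Real.Gamma α : ℝ) : ℂ) * ∫ ξ in (0 : ℝ)..t, (((t - ξ) ^ (α - 1) : ℝ) : ℂ) * v ξ

/-- The Caputo derivative of order `γ ∈ (0, 1)`: the Riemann-Liouville integral of order `1 - γ` of
the first derivative.  For `t ∈ (0, T]` it only depends on the values of `v` on `[0, T]`. -/
def caputo (γ : ℝ) (v : ℝ → ℂ) (t : ℝ) : ℂ :=
  rlIntegral (1 - γ) (deriv v) t

/-- The tempering weight `exp ((lam + p U) t)`. -/
def weight (lam : ℝ) (p : ℂ) (u : ℝ) (t : ℝ) : ℂ :=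
  Complex.exp (((lam : ℂ) + p * (u : ℂ)) * (t : ℂ))

/-- The tempered Caputo-type operator
`exp (-(lam + p U) t) * caputo γ (exp ((lam + p U) t) * v) t`. -/
def temperedCaputo (γ lam : ℝ) (p : ℂ) (u : ℝ) (v : ℝ → ℂ) (t : ℝ) : ℂ :=
  Complex.exp (-(((lam : ℂ) + p * (u : ℂ)) * (t : ℂ))) *
    caputo γ (fun s => weight lam p u s * v s) t

/-- The Fourier transform with the convention `∫ exp (-i ω t) v(t) dt`. -/
def fourierT (v : ℝ → ℂ) (ω : ℝ) : ℂ :=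
  ∫ t : ℝ, Complex.exp (-(Complex.I * (ω : ℂ) * (t : ℂ))) * v t

/-- The integral `∫ (1 + |ω|) ^ s * |F[v](ω)| dω`. -/
def spectralNorm (s : ℝ) (v : ℝ → ℂ) : ℝ :=
  ∫ ω : ℝ, (1 + |ω|) ^ s * ‖fourierT v ω‖

/-- The class of integrable functions for which `∫ (1 + |ω|) ^ s * |F[v](ω)| dω` is finite. -/
def spectralClass (s : ℝ) : Set (ℝ → ℂ) :=
  {v | Integrable v ∧ Integrable (fun ω : ℝ => (1 + |ω|) ^ s * ‖fourierT v ω‖)}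

/-! ### The continuous problem -/

/-- `G x t` solves, on `[a, b] × [0, T]` and with zero initial and boundary data,
`exp (-(lam + p U) t) * caputo γ (exp ((lam + p U) t) * G) - lam ^ γ * G = K * G_xx + f`. -/
structure IsSolution (a b T γ lam K : ℝ) (p : ℂ) (U : ℝ → ℝ) (f G : ℝ → ℝ → ℂ) : Prop where
  contDiff_time : ∀ x ∈ Icc a b, ContDiffOn ℝ 1 (fun t => G x t) (Icc 0 T)
  equation : ∀ x ∈ Ioo a b, ∀ t ∈ Ioc 0 T,
    temperedCaputo γ lam p (U x) (fun s => G x s) t - ((lam ^ γ : ℝ) : ℂ) * G x t =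
      (K : ℂ) * iteratedDeriv 2 (fun y => G y t) x + f x t
  initial : ∀ x ∈ Icc a b, G x 0 = 0
  left_boundary : ∀ t ∈ Icc 0 T, G a t = 0
  right_boundary : ∀ t ∈ Icc 0 T, G b t = 0

/-- Regularity in space: `G(·, t)` is of class `C^4` on `[a, b]` for every `t ∈ [0, T]`, with a
fourth derivative bounded on `[a, b] × [0, T]`. -/
def SpaceRegular (a b T : ℝ) (G : ℝ → ℝ → ℂ) : Prop :=
  (∀ t ∈ Icc 0 T, ContDiffOn ℝ 4 (fun x => G x t) (Icc a b)) ∧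
  ∃ B : ℝ, ∀ t ∈ Icc 0 T, ∀ x ∈ Icc a b,
    ‖iteratedDerivWithin 4 (fun y => G y t) (Icc a b) x‖ ≤ B

/-- Regularity in time: for every `x ∈ (a, b)` the function `exp ((lam + p U(x)) t) * G x t` on
`[0, T]` has an extension to the real line that vanishes for `t ≤ 0` and lies in the spectral class
of order `1 + γ`, with a bound uniform in `x`. -/
def TimeRegular (a b T γ lam : ℝ) (p : ℂ) (U : ℝ → ℝ) (G : ℝ → ℝ → ℂ) : Prop :=
  ∃ C : ℝ, ∀ x ∈ Ioo a b, ∃ w : ℝ → ℂ,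
    (∀ t ≤ 0, w t = 0) ∧
    (∀ t ∈ Icc 0 T, w t = weight lam p (U x) t * G x t) ∧
    w ∈ spectralClass (1 + γ) ∧ spectralNorm (1 + γ) w ≤ C

/-! ### The finite difference scheme -/

/-- The coefficients of the power series of `(1 - z) ^ γ`. -/
def grunwald (γ : ℝ) (k : ℕ) : ℝ := (-1) ^ k * Ring.choose γ k

/-- The tempered coefficients `exp (-k lam τ) * g_k`. -/
def temperedGrunwald (γ lam τ : ℝ) (k : ℕ) : ℝ := Real.exp (-(k * lam * τ)) * grunwald γ k

/-- The coefficients of the scheme: `d_0 = 1 - exp (-γ lam τ) (lam τ) ^ γ`, and `d_k` is the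
tempered coefficient for `k ≥ 1`. -/
def schemeCoeff (γ lam τ : ℝ) (k : ℕ) : ℝ :=
  if k = 0 then 1 - Real.exp (-(γ * lam * τ)) * (lam * τ) ^ γ else temperedGrunwald γ lam τ k

/-- The grid function `Gh n m` (time level `n ≤ N`, space index `m ≤ M`) is a solution of the
difference scheme with `τ = T / N`, `h = (b - a) / M`, nodes `x_m = a + m h`, `t_n = n τ`, and zero
initial and boundary values. -/
structure IsSchemeSolution (a b T γ lam K : ℝ) (p : ℂ) (U : ℝ → ℝ) (f : ℝ → ℝ → ℂ)
    (N M : ℕ) (τ h : ℝ) (Gh : ℕ → ℕ → ℂ) : Prop where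
  time_step : τ = T / N
  space_step : h = (b - a) / M
  equation : ∀ n ∈ Finset.Icc 1 N, ∀ m ∈ Finset.Icc 1 (M - 1),
    ∑ k ∈ Finset.range (n + 1), ((schemeCoeff γ lam τ k / τ ^ γ : ℝ) : ℂ) *
        (Complex.exp (-(p * (U (a + m * h) : ℂ) * (k : ℂ) * (τ : ℂ))) * Gh (n - k) m) =
      (K : ℂ) * ((Gh n (m - 1) - 2 * Gh n m + Gh n (m + 1)) / (h : ℂ) ^ 2) +
        f (a + m * h) (n * τ)
  initial : ∀ m ≤ M, Gh 0 m = 0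
  left_boundary : ∀ n ≤ N, Gh n 0 = 0
  right_boundary : ∀ n ≤ N, Gh n M = 0

/-- The error `G(x_m, t_n) - Gh n m`. -/
def schemeError (a τ h : ℝ) (G : ℝ → ℝ → ℂ) (Gh : ℕ → ℕ → ℂ) (n m : ℕ) : ℂ :=
  G (a + m * h) (n * τ) - Gh n m

/-- The maximum of `|v_m|` over the interior nodes `1 ≤ m ≤ M - 1` (zero if there are none). -/
def gridMax (M : ℕ) (v : ℕ → ℂ) : ℝ := ((Finset.Icc 1 (M - 1)).sup (fun m => ‖v m‖₊) : NNReal)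

/-- The discrete `H^1` seminorm, from the difference quotients `(v_m - v_{m-1}) / h`,
`1 ≤ m ≤ M`. -/
def gridSeminormOne (M : ℕ) (h : ℝ) (v : ℕ → ℂ) : ℝ :=
  Real.sqrt (h * ∑ m ∈ Finset.Icc 1 M, ‖(v m - v (m - 1)) / (h : ℂ)‖ ^ 2)

/-- The norm `∑_{n=1}^N τ * max_m |v^n_m|`. -/
def tripleNormMax (N M : ℕ) (τ : ℝ) (v : ℕ → ℕ → ℂ) : ℝ :=
  ∑ n ∈ Finset.Icc 1 N, gridMax M (v n) * τ

/-- The norm `(∑_{n=1}^N τ * |v^n|_{h,1}^2) ^ (1/2)`. -/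
def tripleNormOne (N M : ℕ) (τ h : ℝ) (v : ℕ → ℕ → ℂ) : ℝ :=
  Real.sqrt (∑ n ∈ Finset.Icc 1 N, gridSeminormOne M h (v n) ^ 2 * τ)

end

end TemperedFeynmanKac

namespace TemperedFeynmanKac

open MeasureTheory Set

noncomputable section

/-! ### The Grünwald coefficients -/

/-! The error solves the scheme with the truncation error as source, so the bound is consistency
plus stability.

Consistency in time is a comparison of Fourier multipliers. After conjugation by the weight, the
difference operator has symbol `τ^(-γ) (1 - exp (-iωτ))^γ` and the Caputo derivative has `(iω)^γ`;
they differ by `O(τ |ω|^(1+γ))` (`norm_symbol_sub_le`), which the spectral norm of order `1 + γ`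
controls. Since the extended function vanishes for `t ≤ 0`, the whole-line operators agree with the
finite sum and the integral over `[0, t]`. The kernel `s^(-γ)` is not integrable on the half-line,
so it is damped by `exp (-εs)` and `ε → 0` is taken at the end (`norm_damped_grunwald_sub_le`,
`norm_grunwald_sub_le`). The modified `d_0` costs another `O(τ)` (`norm_temporal_truncation_le`).
The central difference costs `O(h²)`.

Stability is an energy argument. The coefficients satisfy `∑_{k≥1} |d_k| ≤ d_0`
(`sum_abs_schemeCoeff_le`), so the real part of the time-discrete form tested against the error,
summed over the time levels, is nonnegative. Summation by parts in space then bounds the squared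
discrete `H¹` seminorm by the pairing of truncation and error (`energy_estimate`). A discrete
Sobolev inequality and Young's inequality close the estimate, and Cauchy-Schwarz in time yields the
maximum norm. -/

theorem grunwald_zero (γ : ℝ) : grunwald γ 0 = 1 := by simp [grunwald]

theorem grunwald_succ (γ : ℝ) (k : ℕ) :
    grunwald γ (k + 1) = grunwald γ k * ((k - γ) / (k + 1)) := by
  have h : Ring.choose γ (k + 1) * (k + 1) = Ring.choose γ k * (γ - k) := by
    simp only [Ring.choose_eq_smul, descPochhammer_succ_right, Polynomial.smeval_mul,
      Polynomial.smeval_sub, Polynomial.smeval_X, Polynomial.smeval_natCast, smul_eq_mul,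
      Nat.factorial_succ]
    have h1 : (k.factorial : ℝ) ≠ 0 := by positivity
    have h2 : (k : ℝ) + 1 ≠ 0 := by positivity
    push_cast
    field_simp
    simp
  have h2 : (k : ℝ) + 1 ≠ 0 := by positivity
  unfold grunwald
  rw [pow_succ, mul_div_assoc', eq_div_iff h2]
  linear_combination (-(-1) ^ k) * h

/-- The ratio `(k - γ) / (k + 1)` of consecutive coefficients is nonpositive only at `k = 0` and
nonnegative afterwards, so the sign changes once. -/
theorem grunwald_nonpos {γ : ℝ} (h₀ : 0 ≤ γ) (h₁ : γ ≤ 1) (k : ℕ) : grunwald γ (k + 1) ≤ 0 := by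
  induction k with
  | zero => simp [grunwald_succ, grunwald_zero, h₀]
  | succ k ih =>
    rw [grunwald_succ]
    refine mul_nonpos_of_nonpos_of_nonneg ih (div_nonneg ?_ (by positivity))
    push_cast
    have : (0 : ℝ) ≤ k := by positivity
    linarith

theorem hasSum_grunwald (γ : ℝ) {z : ℂ} (hz : ‖z‖ < 1) :
    HasSum (fun k => (grunwald γ k : ℂ) * z ^ k) ((1 - z) ^ (γ : ℂ)) := by
  have h := (Complex.one_add_cpow_hasFPowerSeriesOnBall_zero (a := (γ : ℂ))).hasSum
    (y := -z) (by rw [← ENNReal.ofReal_one, Metric.eball_ofReal]; simpa using hz)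
  convert! h using 1
  · funext k
    simp only [binomialSeries_apply, List.ofFn_const, List.prod_replicate, smul_eq_mul, grunwald]
    rw [neg_pow z k, ← Complex.ofReal_choose]
    push_cast
    ring
  · ring_nf

/-- All terms after the first have one sign, so partial sums of the binomial series are bounded by
its value. -/
theorem sum_grunwald_le_of_lt_one {γ r : ℝ} (h₀ : 0 ≤ γ) (h₁ : γ ≤ 1) (hr₀ : 0 ≤ r) (hr₁ : r < 1)
    (n : ℕ) : ∑ k ∈ Finset.range n, -grunwald γ (k + 1) * r ^ (k + 1) ≤ 1 - (1 - r) ^ γ := by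
  have h := hasSum_grunwald γ (z := (r : ℂ)) (by simpa [abs_of_nonneg hr₀] using hr₁)
  have h' : HasSum (fun k => grunwald γ k * r ^ k) ((1 - r) ^ γ) := by
    rw [← Complex.hasSum_ofReal, Complex.ofReal_cpow (by linarith)]
    push_cast
    exact h
  rw [← hasSum_nat_add_iff' 1] at h'
  have h2 := h'.neg
  simp only [Finset.sum_range_one, grunwald_zero, pow_zero, mul_one, neg_sub] at h2
  refine le_trans (le_of_eq (Finset.sum_congr rfl fun k _ => neg_mul _ _))
    (sum_le_hasSum _ (fun k _ => ?_) h2)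
  have := mul_nonneg (neg_nonneg.2 (grunwald_nonpos h₀ h₁ k)) (pow_nonneg hr₀ (k + 1))
  linarith

/-- Continuity extends the bound to `r = 1`, the value that occurs when `lam = 0`. -/
theorem sum_grunwald_le {γ r : ℝ} (h₀ : 0 < γ) (h₁ : γ ≤ 1) (hr₀ : 0 ≤ r) (hr₁ : r ≤ 1) (n : ℕ) :
    ∑ k ∈ Finset.range n, -grunwald γ (k + 1) * r ^ (k + 1) ≤ 1 - (1 - r) ^ γ := by
  have key : ∀ x ∈ closure (Ico (0 : ℝ) 1),
      ∑ k ∈ Finset.range n, -grunwald γ (k + 1) * x ^ (k + 1) ≤ 1 - (1 - x) ^ γ := by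
    intro x hx
    refine le_on_closure (s := Ico (0 : ℝ) 1)
      (f := fun x => ∑ k ∈ Finset.range n, -grunwald γ (k + 1) * x ^ (k + 1))
      (g := fun x => 1 - (1 - x) ^ γ)
      (fun y hy => sum_grunwald_le_of_lt_one h₀.le h₁ hy.1 hy.2 n) ?_ ?_ hx
    · fun_prop
    · exact (continuous_const.sub ((Real.continuous_rpow_const h₀.le).comp
        (continuous_const.sub continuous_id))).continuousOn
  exact key r (by rw [closure_Ico (by norm_num)]; exact ⟨hr₀, hr₁⟩)

/-- With `s = lam τ` and `r = exp (-s)`, the claim reduces to `s exp (-s) ≤ 1 - exp (-s)`, that is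
`1 + s ≤ exp s`. This diagonal dominance is the source of stability. -/
theorem sum_abs_schemeCoeff_le {γ lam τ : ℝ} (h₀ : 0 < γ) (h₁ : γ ≤ 1) (hlam : 0 ≤ lam)
    (hτ : 0 ≤ τ) (n : ℕ) :
    ∑ k ∈ Finset.range n, |schemeCoeff γ lam τ (k + 1)| ≤ schemeCoeff γ lam τ 0 := by
  have hs : 0 ≤ lam * τ := mul_nonneg hlam hτ
  have h := sum_grunwald_le h₀ h₁ (Real.exp_pos (-(lam * τ))).le (Real.exp_le_one_iff.2 (by linarith)) n
  have e : ∀ k : ℕ, |schemeCoeff γ lam τ (k + 1)| =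
      -grunwald γ (k + 1) * Real.exp (-(lam * τ)) ^ (k + 1) := by
    intro k
    rw [schemeCoeff, if_neg k.succ_ne_zero, temperedGrunwald, abs_mul, Real.abs_exp,
      abs_of_nonpos (grunwald_nonpos h₀.le h₁ k), ← Real.exp_nat_mul, mul_comm]
    congr 2
    ring
  simp only [e]
  refine h.trans ?_
  rw [schemeCoeff, if_pos rfl]
  have h2 : Real.exp (-(γ * lam * τ)) * (lam * τ) ^ γ = (lam * τ * Real.exp (-(lam * τ))) ^ γ := by
    rw [Real.mul_rpow hs (Real.exp_pos _).le, ← Real.exp_mul, mul_comm]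
    congr 2
    ring
  rw [h2]
  refine sub_le_sub_left (Real.rpow_le_rpow (by positivity) ?_ h₀.le) 1
  have h3 := Real.add_one_le_exp (lam * τ)
  have h4 : Real.exp (lam * τ) * Real.exp (-(lam * τ)) = 1 := by rw [← Real.exp_add]; simp
  nlinarith [Real.exp_pos (-(lam * τ))]

/-! ### The symbol of the difference operator -/

theorem re_one_sub_exp_neg_pos {u : ℂ} (hu : 0 < u.re) : 0 < (1 - Complex.exp (-u)).re := by
  have h : (Complex.exp (-u)).re < 1 := by
    refine lt_of_le_of_lt (Complex.re_le_norm _) ?_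
    rw [Complex.norm_exp]
    exact Real.exp_lt_one_iff.2 (by simpa using hu)
  simpa using h

/-- For small `u`, the mean value inequality for `y^γ` between `u` and `1 - exp (-u) = u + O(u²)`;
otherwise both powers are bounded separately. The constant 10 comes from the second case, where `5
‖u‖^γ ≤ 10 ‖u‖^(1+γ)`. -/
theorem norm_symbol_sub_le {γ : ℝ} (h₀ : 0 ≤ γ) (h₁ : γ ≤ 1) {u : ℂ} (hu : 0 < u.re) :
    ‖(1 - Complex.exp (-u)) ^ (γ : ℂ) - u ^ (γ : ℂ)‖ ≤ 10 * ‖u‖ ^ (1 + γ) := by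
  have hpos : 0 < (1 - Complex.exp (-u)).re := re_one_sub_exp_neg_pos hu
  have hu0 : u ≠ 0 := fun h => by simp [h] at hu
  have hn : 0 < ‖u‖ := norm_pos_iff.2 hu0
  have hu1 : ‖u‖ ^ (1 + γ) = ‖u‖ * ‖u‖ ^ γ := by rw [Real.rpow_add hn, Real.rpow_one]
  have hnγ : 0 < ‖u‖ ^ γ := Real.rpow_pos_of_pos hn γ
  rcases le_or_gt ‖u‖ (1 / 2) with hle | hgt
  · have hd : ‖(1 - Complex.exp (-u)) - u‖ ≤ ‖u‖ ^ 2 := by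
      have := Complex.norm_exp_sub_one_sub_id_le (x := -u) (by rw [norm_neg]; linarith)
      rw [norm_neg] at this
      rw [← norm_neg]
      convert! this using 2
      ring
    -- The segment avoids the branch cut, and since `‖u‖² ≤ ‖u‖ / 2` it also keeps its distance from
    -- the origin.
    have hseg : ∀ y ∈ segment ℝ u (1 - Complex.exp (-u)), 0 < y.re ∧ ‖u‖ / 2 ≤ ‖y‖ := by
      intro y hy
      constructor
      · exact (convex_halfSpace_re_gt 0).segment_subset (by simpa using hu) (by simpa using hpos) hy
      · have h1 : ‖y - u‖ ≤ ‖(1 - Complex.exp (-u)) - u‖ := by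
          have := norm_sub_le_of_mem_segment hy
          exact this
        have h2 := norm_sub_norm_le u y
        rw [norm_sub_rev] at h2
        nlinarith
    have hm := (convex_segment u (1 - Complex.exp (-u))).norm_image_sub_le_of_norm_hasDerivWithin_le
      (𝕜 := ℂ) (f := fun y : ℂ => y ^ (γ : ℂ)) (f' := fun y => (γ : ℂ) * y ^ ((γ : ℂ) - 1) * 1)
      (C := 2 * (‖u‖ ^ γ / ‖u‖))
      (fun y hy => ((hasDerivAt_id y).cpow_const (Or.inl (hseg y hy).1)).hasDerivWithinAt)
      (fun y hy => ?_) (left_mem_segment ℝ _ _) (right_mem_segment ℝ _ _)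
    · refine hm.trans ?_
      calc 2 * (‖u‖ ^ γ / ‖u‖) * ‖1 - Complex.exp (-u) - u‖
          ≤ 2 * (‖u‖ ^ γ / ‖u‖) * ‖u‖ ^ 2 := by gcongr
        _ = 2 * (‖u‖ * ‖u‖ ^ γ) := by field_simp
        _ ≤ 10 * ‖u‖ ^ (1 + γ) := by rw [hu1]; nlinarith [mul_pos hn hnγ]
    · obtain ⟨hy1, hy2⟩ := hseg y hy
      have hy0 : y ≠ 0 := fun h => by simp [h] at hy1
      rw [mul_one, norm_mul, Complex.norm_real, Real.norm_of_nonneg h₀]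
      have e : ((γ : ℂ) - 1) = ((γ - 1 : ℝ) : ℂ) := by push_cast; ring
      rw [e, Complex.norm_cpow_real]
      calc γ * ‖y‖ ^ (γ - 1) ≤ 1 * ‖y‖ ^ (γ - 1) := by gcongr
        _ ≤ (‖u‖ / 2) ^ (γ - 1) := by
          rw [one_mul]
          exact Real.rpow_le_rpow_of_nonpos (by positivity) hy2 (by linarith)
        _ = (1 / 2) ^ (γ - 1) * (‖u‖ ^ γ / ‖u‖) := by
          rw [← Real.rpow_sub_one hn.ne', ← Real.mul_rpow (by norm_num) hn.le]
          congr 1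
          ring
        _ ≤ 2 * (‖u‖ ^ γ / ‖u‖) := by
          gcongr
          calc (1 / 2 : ℝ) ^ (γ - 1) ≤ (1 / 2) ^ (-1 : ℝ) :=
                Real.rpow_le_rpow_of_exponent_ge (by norm_num) (by norm_num) (by linarith)
            _ = 2 := by rw [Real.rpow_neg_one]; norm_num
  · have h1 : ‖(1 - Complex.exp (-u)) ^ (γ : ℂ)‖ ≤ 4 * ‖u‖ ^ γ := by
      rw [Complex.norm_cpow_real]
      have h2 : ‖1 - Complex.exp (-u)‖ ≤ 4 * ‖u‖ := by
        have h3 : ‖Complex.exp (-u)‖ ≤ 1 := by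
          rw [Complex.norm_exp]
          exact Real.exp_le_one_iff.2 (by simpa using hu.le)
        calc _ ≤ ‖(1 : ℂ)‖ + ‖Complex.exp (-u)‖ := norm_sub_le _ _
          _ ≤ 4 * ‖u‖ := by rw [norm_one]; linarith
      calc ‖1 - Complex.exp (-u)‖ ^ γ ≤ (4 * ‖u‖) ^ γ := by gcongr
        _ = 4 ^ γ * ‖u‖ ^ γ := Real.mul_rpow (by norm_num) hn.le
        _ ≤ 4 ^ (1 : ℝ) * ‖u‖ ^ γ := by
          gcongr
          norm_num
        _ = 4 * ‖u‖ ^ γ := by rw [Real.rpow_one]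
    calc _ ≤ ‖(1 - Complex.exp (-u)) ^ (γ : ℂ)‖ + ‖u ^ (γ : ℂ)‖ := norm_sub_le _ _
      _ ≤ 4 * ‖u‖ ^ γ + ‖u‖ ^ γ := by
        rw [Complex.norm_cpow_real u]
        linarith
      _ ≤ 10 * ‖u‖ ^ (1 + γ) := by rw [hu1]; nlinarith

/-! ### The Laplace transform of a power -/

theorem integrableOn_rpow_mul_exp {a r : ℝ} (ha : 0 < a) (hr : 0 < r) :
    IntegrableOn (fun s : ℝ => s ^ (a - 1) * Real.exp (-(r * s))) (Ioi 0) := by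
  have h := integrableOn_rpow_mul_exp_neg_mul_rpow (p := 1) (s := a - 1) (by linarith)
    one_pos hr
  simpa using h

theorem norm_rpow_mul_cexp (a : ℝ) (z : ℂ) {s : ℝ} (hs : 0 < s) :
    ‖((s ^ (a - 1) : ℝ) : ℂ) * Complex.exp (-(z * s))‖ =
      s ^ (a - 1) * Real.exp (-(z.re * s)) := by
  rw [norm_mul, Complex.norm_real, Complex.norm_exp,
    Real.norm_of_nonneg (Real.rpow_nonneg hs.le _)]
  simp

/-- Differentiation under the integral; on the half-plane `Re w > Re z / 2` the derivative has a
common integrable majorant. -/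
theorem hasDerivAt_laplace_rpow {a : ℝ} (ha : 0 < a) {z : ℂ} (hz : 0 < z.re) :
    ∃ y, HasDerivAt
      (fun z : ℂ => ∫ s in Ioi (0 : ℝ), ((s ^ (a - 1) : ℝ) : ℂ) * Complex.exp (-(z * s))) y z := by
  have hopen : {w : ℂ | z.re / 2 < w.re} ∈ nhds z :=
    (isOpen_lt continuous_const Complex.continuous_re).mem_nhds (by simpa using by linarith)
  have hmeas : ∀ w : ℂ, Measurable fun s : ℝ => ((s ^ (a - 1) : ℝ) : ℂ) * Complex.exp (-(w * s)) :=
    fun w => by fun_prop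
  refine ⟨_, (hasDerivAt_integral_of_dominated_loc_of_deriv_le
    (F := fun (w : ℂ) (s : ℝ) => ((s ^ (a - 1) : ℝ) : ℂ) * Complex.exp (-(w * s)))
    (F' := fun (w : ℂ) (s : ℝ) => ((s ^ (a - 1) : ℝ) : ℂ) * (Complex.exp (-(w * s)) * (-(1 * s))))
    (bound := fun s => s ^ (a + 1 - 1) * Real.exp (-(z.re / 2 * s)))
    hopen (Filter.Eventually.of_forall fun w => (hmeas w).aestronglyMeasurable)
    ?_ ?_ ?_ (integrableOn_rpow_mul_exp (by linarith) (by linarith)) ?_).2⟩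
  · refine (integrableOn_rpow_mul_exp ha hz).mono' (hmeas z).aestronglyMeasurable ?_
    filter_upwards [ae_restrict_mem measurableSet_Ioi] with s hs
    exact (norm_rpow_mul_cexp a z hs).le
  · refine Measurable.aestronglyMeasurable ?_
    fun_prop
  · filter_upwards [ae_restrict_mem measurableSet_Ioi] with s hs w hw
    have hs : 0 < s := hs
    rw [← mul_assoc, norm_mul, norm_rpow_mul_cexp a w hs, norm_neg, one_mul, Complex.norm_real,
      Real.norm_of_nonneg hs.le, show a + 1 - 1 = (a - 1) + 1 by ring, Real.rpow_add_one hs.ne']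
    have hw : z.re / 2 < w.re := hw
    have : Real.exp (-(w.re * s)) ≤ Real.exp (-(z.re / 2 * s)) := by gcongr
    calc s ^ (a - 1) * Real.exp (-(w.re * s)) * s
        ≤ s ^ (a - 1) * Real.exp (-(z.re / 2 * s)) * s := by gcongr
      _ = s ^ (a - 1) * s * Real.exp (-(z.re / 2 * s)) := by ring
  · refine Filter.Eventually.of_forall fun s w _ => HasDerivAt.const_mul _ ?_
    exact (((hasDerivAt_id w).mul_const (s : ℂ)).neg).cexp

/-- Both sides are analytic on the right half-plane and agree on the positive real axis by the Gamma
integral; the identity theorem does the rest. -/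
theorem laplace_rpow {a : ℝ} (ha : 0 < a) {z : ℂ} (hz : 0 < z.re) :
    ∫ s in Ioi (0 : ℝ), ((s ^ (a - 1) : ℝ) : ℂ) * Complex.exp (-(z * s)) =
      (Real.Gamma a : ℂ) * z ^ (-(a : ℂ)) := by
  have hopen : IsOpen {w : ℂ | 0 < w.re} := isOpen_lt continuous_const Complex.continuous_re
  have h1 : AnalyticOnNhd ℂ (fun z : ℂ =>
      ∫ s in Ioi (0 : ℝ), ((s ^ (a - 1) : ℝ) : ℂ) * Complex.exp (-(z * s))) {w | 0 < w.re} := by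
    refine DifferentiableOn.analyticOnNhd (fun w hw => ?_) hopen
    obtain ⟨y, hy⟩ := hasDerivAt_laplace_rpow ha hw
    exact hy.differentiableAt.differentiableWithinAt
  have h2 : AnalyticOnNhd ℂ (fun z : ℂ => (Real.Gamma a : ℂ) * z ^ (-(a : ℂ))) {w | 0 < w.re} := by
    refine DifferentiableOn.analyticOnNhd (fun w hw => ?_) hopen
    exact (((hasDerivAt_id w).cpow_const (Or.inl hw)).const_mul
      _).differentiableAt.differentiableWithinAt
  refine h1.eqOn_of_preconnected_of_frequently_eq h2
    (convex_halfSpace_re_gt 0).isPreconnected (z₀ := 1) (by simp) ?_ hz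
  have hreal : ∀ r : ℝ, 0 < r →
      ∫ s in Ioi (0 : ℝ), ((s ^ (a - 1) : ℝ) : ℂ) * Complex.exp (-((r : ℂ) * s)) =
      (Real.Gamma a : ℂ) * (r : ℂ) ^ (-(a : ℂ)) := by
    intro r hr
    have h := Complex.integral_cpow_mul_exp_neg_mul_Ioi (a := (a : ℂ)) (by simpa using ha) hr
    rw [Complex.Gamma_ofReal, one_div, Complex.inv_cpow _ _ (by
      rw [Complex.arg_ofReal_of_nonneg hr.le]; exact Real.pi_pos.ne), ← Complex.cpow_neg,
      mul_comm] at h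
    rw [← h]
    refine setIntegral_congr_fun measurableSet_Ioi fun s hs => ?_
    have hs : 0 < s := hs
    rw [Complex.ofReal_cpow hs.le]
    push_cast
    rfl
  -- The real points `1 + 1/(n+1)` accumulate at 1 without reaching it.
  have ht : Filter.Tendsto (fun n : ℕ => ((1 + 1 / ((n : ℝ) + 1) : ℝ) : ℂ)) Filter.atTop
      (nhdsWithin 1 {1}ᶜ) := by
    refine tendsto_nhdsWithin_iff.2 ⟨?_, Filter.Eventually.of_forall fun n => ?_⟩
    · have := (tendsto_one_div_add_atTop_nhds_zero_nat (𝕜 := ℝ)).const_add 1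
      rw [add_zero] at this
      exact (Complex.continuous_ofReal.tendsto 1).comp this
    · have : (0 : ℝ) < 1 / ((n + 1 : ℕ) : ℝ) := by positivity
      simp only [mem_compl_iff, mem_singleton_iff]
      norm_cast
      linarith
  exact ht.frequently (Filter.Frequently.of_forall fun n => hreal _ (by positivity))

/-! ### Inverse Fourier integrals -/

/-- The inverse Fourier integral `(2π)⁻¹ ∫ φ(ω) exp (i ω t) dω`. -/
def invFourierT (φ : ℝ → ℂ) (t : ℝ) : ℂ :=
  ((2 * Real.pi)⁻¹ : ℝ) * ∫ ω : ℝ, φ ω * Complex.exp (Complex.I * ω * t)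

theorem norm_cexp_I_mul (ω t : ℝ) : ‖Complex.exp (Complex.I * ω * t)‖ = 1 := by
  rw [Complex.norm_exp]
  simp

theorem integrable_mul_cexp {φ : ℝ → ℂ} (hφ : Integrable φ) (t : ℝ) :
    Integrable (fun ω : ℝ => φ ω * Complex.exp (Complex.I * ω * t)) :=
  hφ.mul_bdd (c := 1) (Continuous.aestronglyMeasurable (by fun_prop))
    (Filter.Eventually.of_forall fun ω => (norm_cexp_I_mul ω t).le)

theorem norm_invFourierT_le (φ : ℝ → ℂ) (t : ℝ) : ‖invFourierT φ t‖ ≤ ∫ ω, ‖φ ω‖ := by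
  have h1 : (2 * Real.pi)⁻¹ ≤ 1 := inv_le_one_of_one_le₀ (by linarith [Real.two_le_pi])
  have h2 : ‖∫ ω : ℝ, φ ω * Complex.exp (Complex.I * ω * t)‖ ≤ ∫ ω, ‖φ ω‖ := by
    refine (norm_integral_le_integral_norm _).trans (le_of_eq ?_)
    simp [norm_cexp_I_mul]
  rw [invFourierT, norm_mul, Complex.norm_real, Real.norm_of_nonneg (by positivity)]
  exact (mul_le_of_le_one_left (norm_nonneg _) h1).trans h2

theorem continuous_invFourierT {φ : ℝ → ℂ} (hφ : Integrable φ) : Continuous (invFourierT φ) := by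
  refine continuous_const.mul (continuous_of_dominated (bound := fun ω => ‖φ ω‖)
    (fun t => (integrable_mul_cexp hφ t).aestronglyMeasurable)
    (fun t => Filter.Eventually.of_forall fun ω => ?_) hφ.norm
    (Filter.Eventually.of_forall fun ω => by fun_prop))
  rw [norm_mul, norm_cexp_I_mul, mul_one]

theorem hasDerivAt_invFourierT {φ : ℝ → ℂ} (hφ : Integrable φ)
    (hφ' : Integrable (fun ω : ℝ => Complex.I * ω * φ ω)) (t : ℝ) :
    HasDerivAt (invFourierT φ) (invFourierT (fun ω : ℝ => Complex.I * ω * φ ω) t) t := by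
  refine HasDerivAt.const_mul _ ?_
  refine (hasDerivAt_integral_of_dominated_loc_of_deriv_le (s := univ)
    (F := fun (t : ℝ) (ω : ℝ) => φ ω * Complex.exp (Complex.I * ω * t))
    (F' := fun (t : ℝ) (ω : ℝ) => Complex.I * ω * φ ω * Complex.exp (Complex.I * ω * t))
    (bound := fun ω => ‖Complex.I * ω * φ ω‖) Filter.univ_mem
    (Filter.Eventually.of_forall fun t => (integrable_mul_cexp hφ t).aestronglyMeasurable)
    (integrable_mul_cexp hφ t) (integrable_mul_cexp hφ' t).aestronglyMeasurable
    (Filter.Eventually.of_forall fun ω s _ => ?_) hφ'.norm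
    (Filter.Eventually.of_forall fun ω s _ => ?_)).2
  · rw [norm_mul, norm_cexp_I_mul, mul_one]
  · have h := (((Complex.ofRealCLM.hasDerivAt (x := s)).const_mul (Complex.I * ω)).cexp).const_mul
      (φ ω)
    convert! h using 1
    simp
    ring

theorem fourierT_eq_fourier (v : ℝ → ℂ) (ω : ℝ) :
    fourierT v (2 * Real.pi * ω) = FourierTransform.fourier v ω := by
  rw [Real.fourier_real_eq_integral_exp_smul, fourierT]
  refine integral_congr_ae (Filter.Eventually.of_forall fun t => ?_)
  simp only [smul_eq_mul]
  congr 2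
  push_cast
  ring

theorem continuous_fourierT {v : ℝ → ℂ} (hv : Integrable v) : Continuous (fourierT v) := by
  refine continuous_of_dominated (bound := fun t => ‖v t‖) (fun ω => ?_)
    (fun ω => Filter.Eventually.of_forall fun t => ?_) hv.norm
    (Filter.Eventually.of_forall fun t => by fun_prop)
  · exact (Continuous.aestronglyMeasurable (by fun_prop)).mul hv.aestronglyMeasurable
  · rw [norm_mul, Complex.norm_exp]
    simp

theorem invFourierT_fourierT {v : ℝ → ℂ} (hv : Integrable v) (hv' : Integrable (fourierT v))
    {t : ℝ} (ht : ContinuousAt v t) : invFourierT (fourierT v) t = v t := by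
  have h2π : 2 * Real.pi ≠ 0 := by positivity
  have he : (fun ω => fourierT v (2 * Real.pi * ω)) = FourierTransform.fourier v :=
    funext (fourierT_eq_fourier v)
  have hint : Integrable (FourierTransform.fourier v) := by
    rw [← he]
    exact hv'.comp_mul_left' h2π
  rw [← hv.fourierInv_fourier_eq hint ht, Real.fourierInv_eq', ← he, invFourierT]
  have h := Measure.integral_comp_mul_left
    (fun ω : ℝ => fourierT v ω * Complex.exp (Complex.I * ω * t)) (2 * Real.pi)
  rw [abs_of_nonneg (by positivity), Complex.real_smul] at h
  rw [← h]
  refine integral_congr_ae (Filter.Eventually.of_forall fun ω => ?_)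
  simp only [smul_eq_mul]
  rw [mul_comm]
  congr 2
  simp
  ring

/-! ### Damped convolutions as Fourier multipliers -/

/-- Fubini: the `s`-integral of the damped kernel against `exp (-iωs)` is the Laplace transform at
`ε + iω`. Damping supplies the integrability. -/
theorem integral_rpow_mul_exp_invFourierT {a ε : ℝ} (ha : 0 < a) (hε : 0 < ε) {ψ : ℝ → ℂ}
    (hψ : Integrable ψ) (t : ℝ) :
    ∫ s in Ioi (0 : ℝ), ((s ^ (a - 1) * Real.exp (-(ε * s)) : ℝ) : ℂ) * invFourierT ψ (t - s) =
      (Real.Gamma a : ℂ) *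
        invFourierT (fun ω => ψ ω * ((ε : ℂ) + Complex.I * ω) ^ (-(a : ℂ))) t := by
  have hint : Integrable (fun q : ℝ × ℝ => ((q.1 ^ (a - 1) * Real.exp (-(ε * q.1)) : ℝ) : ℂ) *
      ψ q.2 * Complex.exp (Complex.I * q.2 * ((t - q.1 : ℝ) : ℂ)))
      ((volume.restrict (Ioi 0)).prod volume) := by
    refine Integrable.mul_bdd (c := 1)
      (Integrable.mul_prod (integrableOn_rpow_mul_exp ha hε).ofReal hψ)
      (Continuous.aestronglyMeasurable (by fun_prop))
      (Filter.Eventually.of_forall fun q => (norm_cexp_I_mul _ _).le)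
  have hswap := integral_integral_swap
    (f := fun (s ω : ℝ) => ((s ^ (a - 1) * Real.exp (-(ε * s)) : ℝ) : ℂ) *
      ψ ω * Complex.exp (Complex.I * ω * ((t - s : ℝ) : ℂ))) hint
  calc _ = ((2 * Real.pi)⁻¹ : ℝ) * ∫ s in Ioi (0 : ℝ), ∫ ω : ℝ,
        ((s ^ (a - 1) * Real.exp (-(ε * s)) : ℝ) : ℂ) *
          ψ ω * Complex.exp (Complex.I * ω * ((t - s : ℝ) : ℂ)) := by
        rw [← integral_const_mul]
        congr 1 with s
        rw [invFourierT, mul_left_comm, ← integral_const_mul]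
        congr 2 with ω
        ring
    _ = _ := by
        rw [hswap, invFourierT, mul_left_comm (Real.Gamma a : ℂ),
          ← integral_const_mul (Real.Gamma a : ℂ)]
        congr 1
        refine integral_congr_ae (Filter.Eventually.of_forall fun ω => ?_)
        beta_reduce
        have hz : 0 < ((ε : ℂ) + Complex.I * ω).re := by simpa using hε
        have hl := laplace_rpow ha hz
        calc _ = ∫ s in Ioi (0 : ℝ), (ψ ω * Complex.exp (Complex.I * ω * t)) *
              (((s ^ (a - 1) : ℝ) : ℂ) * Complex.exp (-(((ε : ℂ) + Complex.I * ω) * s))) := by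
              congr 1 with s
              have : Complex.exp (Complex.I * ω * ((t - s : ℝ) : ℂ)) =
                  Complex.exp (Complex.I * ω * t) * Complex.exp (-(Complex.I * ω * s)) := by
                rw [← Complex.exp_add]
                congr 1
                push_cast
                ring
              rw [this, show -(((ε : ℂ) + Complex.I * ω) * s) = -(ε * s) + -(Complex.I * ω * s) by
                ring, Complex.exp_add]
              push_cast
              ring
          _ = _ := by
              rw [integral_const_mul, hl]
              ring

theorem norm_cexp_neg_add_mul_I_mul (ε ω τ : ℝ) :
    ‖Complex.exp (-(((ε : ℂ) + Complex.I * ω) * τ))‖ = Real.exp (-(ε * τ)) := by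
  rw [Complex.norm_exp]
  simp

/-- Damping puts `exp (-(ε + iω)τ)` strictly inside the unit disc with modulus independent of `ω`,
so the binomial series may be integrated term by term. -/
theorem hasSum_grunwald_invFourierT (γ : ℝ) {ε τ : ℝ} (hε : 0 < ε) (hτ : 0 < τ) {φ : ℝ → ℂ}
    (hφ : Integrable φ) (t : ℝ) :
    HasSum (fun k : ℕ => (grunwald γ k : ℂ) * (Real.exp (-(ε * (k * τ))) : ℝ) *
        invFourierT φ (t - k * τ))
      (invFourierT (fun ω => φ ω *
        (1 - Complex.exp (-(((ε : ℂ) + Complex.I * ω) * τ))) ^ (γ : ℂ)) t) := by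
  set r : ℝ := Real.exp (-(ε * τ)) with hr
  have hr1 : r < 1 := Real.exp_lt_one_iff.2 (by nlinarith)
  have hr0 : 0 < r := Real.exp_pos _
  have hrk : ∀ k : ℕ, Real.exp (-(ε * (k * τ))) = r ^ k := fun k => by
    rw [hr, ← Real.exp_nat_mul]
    congr 1
    ring
  have hsum : Summable fun k : ℕ => |grunwald γ k| * r ^ k := by
    have h := (hasSum_grunwald γ (z := (r : ℂ)) (by simpa [abs_of_pos hr0] using hr1)).summable.norm
    refine h.congr fun k => ?_
    simp [abs_of_pos hr0]
  have key := hasSum_integral_of_summable_integral_norm (μ := (volume : Measure ℝ))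
    (F := fun (k : ℕ) (ω : ℝ) => ((grunwald γ k : ℂ) * (r ^ k : ℝ)) *
      (φ ω * Complex.exp (Complex.I * ω * ((t - k * τ : ℝ) : ℂ))))
    (fun k => (integrable_mul_cexp hφ _).const_mul _) (by
      refine (hsum.mul_right (∫ ω, ‖φ ω‖)).congr fun k => ?_
      rw [← integral_const_mul]
      congr 1 with ω
      rw [norm_mul, norm_mul (φ ω), norm_mul, norm_cexp_I_mul, mul_one, Complex.norm_real,
        Complex.norm_real, Real.norm_eq_abs, Real.norm_of_nonneg (pow_nonneg hr0.le k)])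
  have key2 := key.mul_left (((2 * Real.pi)⁻¹ : ℝ) : ℂ)
  convert! key2 using 1
  · funext k
    rw [integral_const_mul, hrk, invFourierT]
    ring
  · rw [invFourierT]
    congr 2 with ω
    have hs := (hasSum_grunwald γ (z := Complex.exp (-(((ε : ℂ) + Complex.I * ω) * τ))) (by
      rw [norm_cexp_neg_add_mul_I_mul]; exact hr1)).mul_left
        (φ ω * Complex.exp (Complex.I * ω * t))
    rw [mul_right_comm, ← hs.tsum_eq]
    congr 1 with k
    have : Complex.exp (-(((ε : ℂ) + Complex.I * ω) * τ)) ^ k * Complex.exp (Complex.I * ω * t) =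
        ((r ^ k : ℝ) : ℂ) * Complex.exp (Complex.I * ω * ((t - k * τ : ℝ) : ℂ)) := by
      rw [← hrk, Complex.ofReal_exp, ← Complex.exp_nat_mul, ← Complex.exp_add, ← Complex.exp_add]
      congr 1
      push_cast
      ring
    linear_combination (grunwald γ k : ℂ) * φ ω * this

/-- With `z = ε + iω`, one has `iω z^(γ-1) = z^γ - ε z^(γ-1)`. The first term is compared through
the symbol estimate at `u = zτ`; the second is at most `ε^γ` because `‖z‖ ≥ ε`. -/
theorem norm_multiplier_sub_le {γ τ ε : ℝ} (h₀ : 0 < γ) (h₁ : γ < 1) (hτ : 0 < τ) (hε : 0 < ε)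
    (hε1 : ε ≤ 1) (ω : ℝ) :
    ‖((τ ^ (-γ) : ℝ) : ℂ) * (1 - Complex.exp (-(((ε : ℂ) + Complex.I * ω) * τ))) ^ (γ : ℂ) -
      Complex.I * ω * ((ε : ℂ) + Complex.I * ω) ^ (-((1 - γ : ℝ) : ℂ))‖ ≤
      (10 * τ + ε ^ γ) * (1 + |ω|) ^ (1 + γ) := by
  set z : ℂ := (ε : ℂ) + Complex.I * ω with hz
  have hzre : 0 < z.re := by simpa [hz] using hε
  have hz0 : z ≠ 0 := fun h => by simp [h] at hzre
  have hzn : ‖z‖ ≤ 1 + |ω| := by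
    refine (norm_add_le _ _).trans (add_le_add ?_ ?_)
    · simpa [abs_of_pos hε] using hε1
    · simp
  have hzε : ε ≤ ‖z‖ := by
    have := Complex.re_le_norm z
    simpa [hz] using this
  have hI : Complex.I * ω = z - ε := by rw [hz]; ring
  have hone : (1 : ℝ) ≤ (1 + |ω|) ^ (1 + γ) :=
    Real.one_le_rpow (by linarith [abs_nonneg ω]) (by linarith)
  have hγ' : -((1 - γ : ℝ) : ℂ) = (γ : ℂ) - 1 := by push_cast; ring
  have hzpow : z * z ^ (-((1 - γ : ℝ) : ℂ)) = z ^ (γ : ℂ) := by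
    rw [hγ', Complex.cpow_sub _ _ hz0, Complex.cpow_one]
    field_simp
  have hτpow : ((τ ^ (-γ) : ℝ) : ℂ) * (z * τ) ^ (γ : ℂ) = z ^ (γ : ℂ) := by
    have hτ0 : (τ : ℂ) ≠ 0 := by exact_mod_cast hτ.ne'
    rw [Complex.ofReal_cpow hτ.le, mul_comm z, Complex.cpow_def_of_ne_zero (mul_ne_zero hτ0 hz0),
      Complex.cpow_def_of_ne_zero hτ0, Complex.cpow_def_of_ne_zero hz0, Complex.log_ofReal_mul hτ hz0,
      ← Complex.exp_add, ← Complex.ofReal_log hτ.le]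
    congr 1
    push_cast
    ring
  have hsplit : ((τ ^ (-γ) : ℝ) : ℂ) * (1 - Complex.exp (-(z * τ))) ^ (γ : ℂ) -
      Complex.I * ω * z ^ (-((1 - γ : ℝ) : ℂ)) =
      ((τ ^ (-γ) : ℝ) : ℂ) * ((1 - Complex.exp (-(z * τ))) ^ (γ : ℂ) - (z * τ) ^ (γ : ℂ)) +
        ε * z ^ (-((1 - γ : ℝ) : ℂ)) := by
    rw [mul_sub, hτpow, hI, sub_mul, hzpow]
    ring
  rw [hsplit]
  refine (norm_add_le _ _).trans ((add_le_add ?_ ?_).trans_eq (add_mul _ _ _).symm)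
  · have h := norm_symbol_sub_le h₀.le h₁.le (u := z * τ) (by simpa using mul_pos hzre hτ)
    rw [norm_mul z, Complex.norm_real, Real.norm_of_nonneg hτ.le] at h
    rw [norm_mul, Complex.norm_real, Real.norm_of_nonneg (Real.rpow_nonneg hτ.le _)]
    calc _ ≤ τ ^ (-γ) * (10 * (‖z‖ * τ) ^ (1 + γ)) := by gcongr
      _ = 10 * (τ ^ (-γ) * τ ^ (1 + γ)) * ‖z‖ ^ (1 + γ) := by
        rw [Real.mul_rpow (norm_nonneg _) hτ.le]
        ring
      _ = 10 * τ * ‖z‖ ^ (1 + γ) := by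
        rw [← Real.rpow_add hτ, show -γ + (1 + γ) = 1 by ring, Real.rpow_one]
      _ ≤ 10 * τ * (1 + |ω|) ^ (1 + γ) := by gcongr
  · rw [norm_mul, Complex.norm_real, Real.norm_of_nonneg hε.le, ← Complex.ofReal_neg,
      Complex.norm_cpow_real]
    calc ε * ‖z‖ ^ (-(1 - γ)) ≤ ε * ε ^ (-(1 - γ)) := by
          gcongr ?_ * ?_
          exact Real.rpow_le_rpow_of_nonpos hε hzε (by linarith)
      _ = ε ^ γ := by
          rw [← Real.rpow_one_add' hε.le (by linarith)]
          congr 1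
          ring
      _ ≤ ε ^ γ * (1 + |ω|) ^ (1 + γ) := le_mul_of_one_le_right (by positivity) hone

/-! ### Consistency of the Grünwald approximation -/

theorem integrable_of_weighted {s : ℝ} (hs : 0 ≤ s) {φ : ℝ → ℂ} (hm : AEStronglyMeasurable φ)
    (h : Integrable (fun ω : ℝ => (1 + |ω|) ^ s * ‖φ ω‖)) : Integrable φ := by
  refine h.mono' hm (Filter.Eventually.of_forall fun ω => ?_)
  exact le_mul_of_one_le_left (norm_nonneg _)
    (Real.one_le_rpow (by linarith [abs_nonneg ω]) hs)

theorem integrable_I_mul_of_weighted {s : ℝ} (hs : 1 ≤ s) {φ : ℝ → ℂ}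
    (hm : AEStronglyMeasurable φ) (h : Integrable (fun ω : ℝ => (1 + |ω|) ^ s * ‖φ ω‖)) :
    Integrable (fun ω : ℝ => Complex.I * ω * φ ω) := by
  refine h.mono' ((Continuous.aestronglyMeasurable (by fun_prop)).mul hm)
    (Filter.Eventually.of_forall fun ω => ?_)
  have hω : (1 : ℝ) ≤ 1 + |ω| := by linarith [abs_nonneg ω]
  have h1 : |ω| ≤ (1 + |ω|) ^ s := by
    calc |ω| ≤ (1 + |ω|) ^ (1 : ℝ) := by rw [Real.rpow_one]; linarith
      _ ≤ (1 + |ω|) ^ s := Real.rpow_le_rpow_of_exponent_le hω hs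
  simp only [norm_mul, Complex.norm_I, one_mul, Complex.norm_real, Real.norm_eq_abs]
  gcongr

theorem invFourierT_sub {φ ψ : ℝ → ℂ} (hφ : Integrable φ) (hψ : Integrable ψ) (c : ℂ) (t : ℝ) :
    c * invFourierT φ t - invFourierT ψ t = invFourierT (fun ω => c * φ ω - ψ ω) t := by
  have h : (∫ ω : ℝ, (c * φ ω - ψ ω) * Complex.exp (Complex.I * ω * t)) =
      c * (∫ ω : ℝ, φ ω * Complex.exp (Complex.I * ω * t)) -
        ∫ ω : ℝ, ψ ω * Complex.exp (Complex.I * ω * t) := by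
    rw [← integral_const_mul, ← integral_sub ((integrable_mul_cexp hφ t).const_mul c)
      (integrable_mul_cexp hψ t)]
    congr 1 with ω
    ring
  rw [invFourierT, invFourierT, invFourierT, h]
  ring

theorem integral_Ioi_rpow_eq_intervalIntegral {W' : ℝ → ℂ} (hW' : ∀ t < 0, W' t = 0)
    (κ : ℝ → ℂ) {t : ℝ} (ht : 0 ≤ t) :
    ∫ s in (0 : ℝ)..t, κ s * W' (t - s) = ∫ s in Ioi (0 : ℝ), κ s * W' (t - s) := by
  rw [intervalIntegral.integral_of_le ht]
  refine (setIntegral_eq_of_subset_of_forall_sdiff_eq_zero measurableSet_Ioi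
    Ioc_subset_Ioi_self fun s hs => ?_).symm
  have : t < s := by
    by_contra h
    exact hs.2 ⟨hs.1, not_lt.1 h⟩
  rw [hW' _ (by linarith), mul_zero]

theorem invFourierT_deriv_eq_zero {φ : ℝ → ℂ} (hφ : Integrable φ)
    (hφ' : Integrable (fun ω : ℝ => Complex.I * ω * φ ω)) (h0 : ∀ t ≤ 0, invFourierT φ t = 0)
    {t : ℝ} (ht : t < 0) : invFourierT (fun ω : ℝ => Complex.I * ω * φ ω) t = 0 := by
  have h1 := hasDerivAt_invFourierT hφ hφ' t
  have h2 : HasDerivAt (invFourierT φ) 0 t := by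
    refine (hasDerivAt_const t (0 : ℂ)).congr_of_eventuallyEq ?_
    filter_upwards [Iio_mem_nhds ht] with s hs
    exact h0 s (le_of_lt hs)
  exact h1.unique h2

/-- Vanishing for negative times lets the finite sum and the integral be read as the full series and
the half-line convolution, so their difference is one inverse Fourier integral with an explicit
multiplier. -/
theorem norm_damped_grunwald_sub_le {γ τ ε : ℝ} (h₀ : 0 < γ) (h₁ : γ < 1) (hτ : 0 < τ)
    (hε : 0 < ε) (hε1 : ε ≤ 1) {φ : ℝ → ℂ} (hm : AEStronglyMeasurable φ)
    (hφ : Integrable (fun ω : ℝ => (1 + |ω|) ^ (1 + γ) * ‖φ ω‖))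
    (h0 : ∀ t ≤ 0, invFourierT φ t = 0) (n : ℕ) :
    ‖((τ ^ (-γ) : ℝ) : ℂ) * ∑ k ∈ Finset.range (n + 1),
        (grunwald γ k : ℂ) * (Real.exp (-(ε * (k * τ))) : ℝ) * invFourierT φ (n * τ - k * τ) -
      ((1 / Real.Gamma (1 - γ) : ℝ) : ℂ) * ∫ s in (0 : ℝ)..(n * τ),
        ((s ^ (1 - γ - 1) * Real.exp (-(ε * s)) : ℝ) : ℂ) *
          invFourierT (fun ω : ℝ => Complex.I * ω * φ ω) (n * τ - s)‖ ≤
      (10 * τ + ε ^ γ) * ∫ ω : ℝ, (1 + |ω|) ^ (1 + γ) * ‖φ ω‖ := by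
  have hφ0 := integrable_of_weighted (by linarith) hm hφ
  have hφ1 := integrable_I_mul_of_weighted (by linarith) hm hφ
  have hsum : ∑ k ∈ Finset.range (n + 1),
        (grunwald γ k : ℂ) * (Real.exp (-(ε * (k * τ))) : ℝ) * invFourierT φ (n * τ - k * τ) =
      invFourierT (fun ω => φ ω *
        (1 - Complex.exp (-(((ε : ℂ) + Complex.I * ω) * τ))) ^ (γ : ℂ)) (n * τ) := by
    refine (hasSum_sum_of_ne_finset_zero fun k hk => ?_).unique
      (hasSum_grunwald_invFourierT γ hε hτ hφ0 (n * τ))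
    have hk' : (n : ℝ) ≤ k := by
      have : n + 1 ≤ k := by simpa using hk
      exact_mod_cast (Nat.le_succ n).trans this
    rw [h0 _ (by nlinarith), mul_zero]
  have hΓ : (Real.Gamma (1 - γ) : ℂ) ≠ 0 := by
    exact_mod_cast (Real.Gamma_pos_of_pos (by linarith)).ne'
  rw [hsum, integral_Ioi_rpow_eq_intervalIntegral
    (fun t ht => invFourierT_deriv_eq_zero hφ0 hφ1 h0 ht)
    (fun s => ((s ^ (1 - γ - 1) * Real.exp (-(ε * s)) : ℝ) : ℂ)) (by positivity),
    integral_rpow_mul_exp_invFourierT (by linarith) hε hφ1, ← mul_assoc, Complex.ofReal_div,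
    Complex.ofReal_one, one_div_mul_cancel hΓ, one_mul]
  have hi1 : Integrable (fun ω : ℝ => φ ω *
      (1 - Complex.exp (-(((ε : ℂ) + Complex.I * ω) * τ))) ^ (γ : ℂ)) := by
    refine hφ0.mul_bdd (c := 2 ^ γ) (Measurable.aestronglyMeasurable (by fun_prop))
      (Filter.Eventually.of_forall fun ω => ?_)
    rw [Complex.norm_cpow_real]
    refine Real.rpow_le_rpow (norm_nonneg _) ((norm_sub_le _ _).trans ?_) h₀.le
    rw [norm_cexp_neg_add_mul_I_mul, norm_one]
    have : Real.exp (-(ε * τ)) ≤ 1 := Real.exp_le_one_iff.2 (by nlinarith)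
    linarith
  have hi2 : Integrable (fun ω : ℝ => Complex.I * ω * φ ω *
      ((ε : ℂ) + Complex.I * ω) ^ (-((1 - γ : ℝ) : ℂ))) := by
    refine hφ1.mul_bdd (c := ε ^ (-(1 - γ))) (Measurable.aestronglyMeasurable (by fun_prop))
      (Filter.Eventually.of_forall fun ω => ?_)
    rw [← Complex.ofReal_neg, Complex.norm_cpow_real]
    refine Real.rpow_le_rpow_of_nonpos hε ?_ (by linarith)
    have := Complex.re_le_norm ((ε : ℂ) + Complex.I * ω)
    simpa using this
  rw [invFourierT_sub hi1 hi2, ← integral_const_mul]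
  refine (norm_invFourierT_le _ _).trans
    (integral_mono ((hi1.const_mul _).sub hi2).norm (hφ.const_mul _) fun ω => ?_)
  have h := mul_le_mul_of_nonneg_right (norm_multiplier_sub_le h₀ h₁ hτ hε hε1 ω)
    (norm_nonneg (φ ω))
  rw [← norm_mul] at h
  refine le_trans (le_of_eq ?_) (h.trans (le_of_eq (by ring)))
  congr 1
  ring

/-- Limit `ε → 0+` in the damped estimate; the integral converges by domination with a multiple of
`s^(-γ)`, integrable on a bounded interval. -/
theorem norm_grunwald_sub_le {γ τ : ℝ} (h₀ : 0 < γ) (h₁ : γ < 1) (hτ : 0 < τ)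
    {φ : ℝ → ℂ} (hm : AEStronglyMeasurable φ)
    (hφ : Integrable (fun ω : ℝ => (1 + |ω|) ^ (1 + γ) * ‖φ ω‖))
    (h0 : ∀ t ≤ 0, invFourierT φ t = 0) (n : ℕ) :
    ‖((τ ^ (-γ) : ℝ) : ℂ) * ∑ k ∈ Finset.range (n + 1),
        (grunwald γ k : ℂ) * invFourierT φ (n * τ - k * τ) -
      ((1 / Real.Gamma (1 - γ) : ℝ) : ℂ) * ∫ s in (0 : ℝ)..(n * τ),
        ((s ^ (1 - γ - 1) : ℝ) : ℂ) *
          invFourierT (fun ω : ℝ => Complex.I * ω * φ ω) (n * τ - s)‖ ≤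
      10 * τ * ∫ ω : ℝ, (1 + |ω|) ^ (1 + γ) * ‖φ ω‖ := by
  have hφ1 := integrable_I_mul_of_weighted (by linarith) hm hφ
  have hc := continuous_invFourierT hφ1
  have hle : nhdsWithin (0 : ℝ) (Ioi 0) ≤ nhds 0 := nhdsWithin_le_nhds
  have hexp : ∀ s : ℝ, Filter.Tendsto (fun ε : ℝ => Real.exp (-(ε * s)))
      (nhdsWithin 0 (Ioi 0)) (nhds 1) := fun s => by
    have : Continuous fun ε : ℝ => Real.exp (-(ε * s)) := by fun_prop
    simpa using (this.tendsto 0).mono_left hle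
  have hright : Filter.Tendsto
      (fun ε : ℝ => (10 * τ + ε ^ γ) * ∫ ω : ℝ, (1 + |ω|) ^ (1 + γ) * ‖φ ω‖)
      (nhdsWithin 0 (Ioi 0)) (nhds (10 * τ * ∫ ω : ℝ, (1 + |ω|) ^ (1 + γ) * ‖φ ω‖)) := by
    have := ((Real.continuous_rpow_const h₀.le).tendsto 0).mono_left hle
    rw [Real.zero_rpow h₀.ne'] at this
    simpa using (this.const_add (10 * τ)).mul_const (∫ ω : ℝ, (1 + |ω|) ^ (1 + γ) * ‖φ ω‖)
  have hleft1 : Filter.Tendsto (fun ε : ℝ => ∑ k ∈ Finset.range (n + 1),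
        (grunwald γ k : ℂ) * (Real.exp (-(ε * (k * τ))) : ℝ) * invFourierT φ (n * τ - k * τ))
      (nhdsWithin 0 (Ioi 0)) (nhds (∑ k ∈ Finset.range (n + 1),
        (grunwald γ k : ℂ) * invFourierT φ (n * τ - k * τ))) := by
    refine tendsto_finsetSum _ fun k _ => ?_
    have := (((Complex.continuous_ofReal.tendsto 1).comp (hexp (k * τ))).const_mul
      (grunwald γ k : ℂ)).mul_const (invFourierT φ (n * τ - k * τ))
    simpa using this
  have hleft2 : Filter.Tendsto (fun ε : ℝ => ∫ s in (0 : ℝ)..(n * τ),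
        ((s ^ (1 - γ - 1) * Real.exp (-(ε * s)) : ℝ) : ℂ) *
          invFourierT (fun ω : ℝ => Complex.I * ω * φ ω) (n * τ - s))
      (nhdsWithin 0 (Ioi 0)) (nhds (∫ s in (0 : ℝ)..(n * τ), ((s ^ (1 - γ - 1) : ℝ) : ℂ) *
          invFourierT (fun ω : ℝ => Complex.I * ω * φ ω) (n * τ - s))) := by
    refine intervalIntegral.tendsto_integral_filter_of_dominated_convergence
      (fun s => s ^ (1 - γ - 1) * ∫ ω : ℝ, ‖Complex.I * ω * φ ω‖)
      (Filter.Eventually.of_forall fun ε => ?_) ?_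
      ((intervalIntegral.intervalIntegrable_rpow' (by linarith)).mul_const _)
      (Filter.Eventually.of_forall fun s _ => ?_)
    · exact ((by fun_prop : Measurable fun s : ℝ =>
        ((s ^ (1 - γ - 1) * Real.exp (-(ε * s)) : ℝ) : ℂ)).mul
          (hc.measurable.comp (by fun_prop))).aestronglyMeasurable
    · filter_upwards [self_mem_nhdsWithin] with ε hε
      refine Filter.Eventually.of_forall fun s hs => ?_
      have hs0 : 0 < s := by
        rw [uIoc_of_le (by positivity)] at hs
        exact hs.1
      have hε : 0 < ε := hε
      rw [norm_mul, Complex.norm_real, Real.norm_of_nonneg (by positivity)]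
      have h1 : Real.exp (-(ε * s)) ≤ 1 := Real.exp_le_one_iff.2 (by nlinarith)
      exact mul_le_mul (mul_le_of_le_one_right (by positivity) h1) (norm_invFourierT_le _ _)
        (norm_nonneg _) (by positivity)
    · have := ((Complex.continuous_ofReal.tendsto _).comp
        ((hexp s).const_mul (s ^ (1 - γ - 1)))).mul_const
        (invFourierT (fun ω : ℝ => Complex.I * ω * φ ω) (n * τ - s))
      simpa using this
  refine le_of_tendsto_of_tendsto ((hleft1.const_mul _).sub (hleft2.const_mul _)).norm hright ?_
  filter_upwards [self_mem_nhdsWithin, hle (Iio_mem_nhds one_pos)] with ε hε hε1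
  exact norm_damped_grunwald_sub_le h₀ h₁ hτ hε (le_of_lt hε1) hm hφ h0 n

/-- Fourier inversion needs continuity points of `w`. The condition `v 0 = 0` glues the two pieces
continuously at 0; at `T`, where `w` may jump, equality follows by continuity of the other two
functions. -/
theorem invFourierT_fourierT_eqOn {T : ℝ} (hT : 0 < T) {v w : ℝ → ℂ}
    (hv : ContinuousOn v (Icc 0 T)) (hv0 : v 0 = 0) (hw0 : ∀ t ≤ 0, w t = 0)
    (hwv : ∀ t ∈ Icc 0 T, w t = v t) (hw : Integrable w) (hw' : Integrable (fourierT w)) :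
    (∀ t ≤ 0, invFourierT (fourierT w) t = 0) ∧ EqOn (invFourierT (fourierT w)) v (Icc 0 T) := by
  have hcont : ∀ t < T, ContinuousAt w t := by
    intro t ht
    have h1 : ContinuousOn (fun t => v (max t 0)) (Iio T) := by
      refine hv.comp (by fun_prop) fun s hs => ⟨le_max_right _ _, max_le (le_of_lt hs) hT.le⟩
    refine (h1.continuousAt (Iio_mem_nhds ht)).congr ?_
    filter_upwards [Iio_mem_nhds ht] with s hs
    rcases le_total s 0 with h | h
    · rw [max_eq_right h, hv0, hw0 s h]
    · rw [max_eq_left h, hwv s ⟨h, le_of_lt hs⟩]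
  have heq : ∀ t < T, invFourierT (fourierT w) t = w t :=
    fun t ht => invFourierT_fourierT hw hw' (hcont t ht)
  refine ⟨fun t ht => (heq t (by linarith)).trans (hw0 t ht), ?_⟩
  refine EqOn.of_subset_closure (s := Ico 0 T) (fun t ht => ?_)
    (continuous_invFourierT hw').continuousOn hv Ico_subset_Icc_self ?_
  · exact (heq t ht.2).trans (hwv t (Ico_subset_Icc_self ht))
  · rw [closure_Ico hT.ne]

theorem caputo_eq_integral_deriv {γ T t : ℝ} (ht0 : 0 ≤ t) (ht : t ≤ T) {v W W' : ℝ → ℂ}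
    (hvW : EqOn W v (Icc 0 T)) (hW : ∀ t, HasDerivAt W (W' t) t) :
    caputo γ v t = ((1 / Real.Gamma (1 - γ) : ℝ) : ℂ) *
      ∫ s in (0 : ℝ)..t, ((s ^ (1 - γ - 1) : ℝ) : ℂ) * W' (t - s) := by
  rw [caputo, rlIntegral]
  congr 1
  have h := intervalIntegral.integral_comp_sub_left (a := 0) (b := t)
    (fun ξ => (((t - ξ) ^ (1 - γ - 1) : ℝ) : ℂ) * W' ξ) t
  simp only [sub_sub_cancel, sub_self, sub_zero] at h
  rw [h]
  -- The point `ξ = t` is discarded: if `t = T`, nothing is known about `v` to its right.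
  refine intervalIntegral.integral_congr_ae ?_
  have hne : ∀ᵐ ξ : ℝ, ξ ≠ t := by simp [ae_iff, measure_singleton]
  filter_upwards [hne] with ξ hξ hmem
  rw [uIoc_of_le ht0] at hmem
  have hlt : ξ < t := lt_of_le_of_ne hmem.2 hξ
  have hd : HasDerivAt v (W' ξ) ξ := by
    refine (hW ξ).congr_of_eventuallyEq ?_
    filter_upwards [Ioo_mem_nhds hmem.1 (hlt.trans_le ht)] with s hs
    exact (hvW (Ioo_subset_Icc_self hs)).symm
  rw [hd.deriv]

theorem norm_grunwald_sub_caputo_le {γ T τ C : ℝ} (h₀ : 0 < γ) (h₁ : γ < 1) (hT : 0 < T)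
    (hτ : 0 < τ) {v w : ℝ → ℂ} (hv : ContinuousOn v (Icc 0 T)) (hv0 : v 0 = 0)
    (hw0 : ∀ t ≤ 0, w t = 0) (hwv : ∀ t ∈ Icc 0 T, w t = v t)
    (hw : w ∈ spectralClass (1 + γ)) (hC : spectralNorm (1 + γ) w ≤ C) {n : ℕ} (hn : n * τ ≤ T) :
    ‖((τ ^ (-γ) : ℝ) : ℂ) * ∑ k ∈ Finset.range (n + 1), (grunwald γ k : ℂ) * v (n * τ - k * τ) -
      caputo γ v (n * τ)‖ ≤ 10 * τ * C := by
  have hm := (continuous_fourierT hw.1).aestronglyMeasurable (μ := volume)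
  have hφ0 := integrable_of_weighted (by linarith) hm hw.2
  have hφ1 := integrable_I_mul_of_weighted (by linarith) hm hw.2
  obtain ⟨hW0, hWv⟩ := invFourierT_fourierT_eqOn hT hv hv0 hw0 hwv hw.1 hφ0
  rw [caputo_eq_integral_deriv (by positivity) hn hWv (hasDerivAt_invFourierT hφ0 hφ1)]
  have hs : ∑ k ∈ Finset.range (n + 1), (grunwald γ k : ℂ) * v (n * τ - k * τ) =
      ∑ k ∈ Finset.range (n + 1), (grunwald γ k : ℂ) *
        invFourierT (fourierT w) (n * τ - k * τ) := by
    refine Finset.sum_congr rfl fun k hk => ?_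
    have hk' : (k : ℝ) ≤ n := by exact_mod_cast Nat.lt_succ_iff.1 (Finset.mem_range.1 hk)
    have hk0 : (0 : ℝ) ≤ k := by positivity
    rw [hWv ⟨by nlinarith, by nlinarith⟩]
  rw [hs]
  refine (norm_grunwald_sub_le h₀ h₁ hτ hm hw.2 hW0 n).trans ?_
  exact mul_le_mul_of_nonneg_left hC (by positivity)

/-- A sup bound from the `L¹` norm of the Fourier transform; it controls the error made by the
modified `d_0`. -/
theorem norm_le_of_spectralNorm_le {s T C : ℝ} (hs : 0 ≤ s) (hT : 0 < T) {v w : ℝ → ℂ}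
    (hv : ContinuousOn v (Icc 0 T)) (hv0 : v 0 = 0)
    (hw0 : ∀ t ≤ 0, w t = 0) (hwv : ∀ t ∈ Icc 0 T, w t = v t)
    (hw : w ∈ spectralClass s) (hC : spectralNorm s w ≤ C) {t : ℝ} (ht : t ∈ Icc 0 T) :
    ‖v t‖ ≤ C := by
  have hm := (continuous_fourierT hw.1).aestronglyMeasurable (μ := volume)
  have hφ0 := integrable_of_weighted hs hm hw.2
  rw [← (invFourierT_fourierT_eqOn hT hv hv0 hw0 hwv hw.1 hφ0).2 ht]
  refine (norm_invFourierT_le _ _).trans (le_trans ?_ hC)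
  refine integral_mono hφ0.norm hw.2 fun ω => ?_
  exact le_mul_of_one_le_left (norm_nonneg _)
    (Real.one_le_rpow (by linarith [abs_nonneg ω]) hs)

/-! ### Consistency of the central difference -/

theorem norm_le_mul_of_hasDerivWithinAt {h C : ℝ} (hC : 0 ≤ C) {ψ ψ' : ℝ → ℂ} (h0 : ψ 0 = 0)
    (hd : ∀ s ∈ Icc 0 h, HasDerivWithinAt ψ (ψ' s) (Icc 0 h) s)
    (hb : ∀ s ∈ Icc 0 h, ‖ψ' s‖ ≤ C) : ∀ s ∈ Icc 0 h, ‖ψ s‖ ≤ C * h := by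
  intro s hs
  have := (convex_Icc 0 h).norm_image_sub_le_of_norm_hasDerivWithin_le hd hb
    (left_mem_Icc.2 (hs.1.trans hs.2)) hs
  rw [h0, sub_zero, sub_zero, Real.norm_of_nonneg hs.1] at this
  exact this.trans (by gcongr; exact hs.2)

/-- The function `g(x+s) + g(x-s) - 2 g(x) - s² g''(x)` vanishes at `s = 0` together with its first
three derivatives. Bounding from the fourth derivative downwards, each mean value step gains a
factor `h`; the constant is not the sharp one. -/
theorem norm_central_difference_sub_le {a b x h B : ℝ} {g : ℝ → ℂ} (hab : a < b) (hh : 0 < h)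
    (hg : ContDiffOn ℝ 4 g (Icc a b))
    (hB : ∀ y ∈ Icc a b, ‖iteratedDerivWithin 4 g (Icc a b) y‖ ≤ B)
    (hl : a ≤ x - h) (hr : x + h ≤ b) :
    ‖(g (x - h) - 2 * g x + g (x + h)) / (h : ℂ) ^ 2 - iteratedDeriv 2 g x‖ ≤ 2 * B * h ^ 2 := by
  have hu := uniqueDiffOn_Icc hab
  have hxI : x ∈ Ioo a b := ⟨by linarith, by linarith⟩
  have hx : x ∈ Icc a b := Ioo_subset_Icc_self hxI
  have hB0 : 0 ≤ B := (norm_nonneg _).trans (hB x hx)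
  have h2 : iteratedDeriv 2 g x = iteratedDerivWithin 2 g (Icc a b) x :=
    (iteratedDerivWithin_eq_iteratedDeriv hu
      ((hg.contDiffAt (Icc_mem_nhds hxI.1 hxI.2)).of_le (by norm_num)) hx).symm
  set D : ℕ → ℝ → ℂ := fun i => iteratedDerivWithin i g (Icc a b) with hD
  have hderiv : ∀ i < 4, ∀ y ∈ Icc a b, HasDerivWithinAt (D i) (D (i + 1) y) (Icc a b) y := by
    intro i hi y hy
    have hdiff := (hg.differentiableOn_iteratedDerivWithin (m := i) (by exact_mod_cast hi) hu) y hy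
    simp only [hD, iteratedDerivWithin_succ]
    exact hdiff.hasDerivWithinAt
  have hplus : ∀ i < 4, ∀ s ∈ Icc 0 h,
      HasDerivWithinAt (fun s => D i (x + s)) (D (i + 1) (x + s)) (Icc 0 h) s := by
    intro i hi s hs
    have := (hderiv i hi (x + s) ⟨by linarith [hs.1], by linarith [hs.2]⟩).scomp s
      (((hasDerivAt_id s).const_add x).hasDerivWithinAt (s := Icc 0 h))
      (fun r hr' => ⟨show a ≤ x + r by linarith [hr'.1], show x + r ≤ b by linarith [hr'.2]⟩)
    simpa [Function.comp_def] using this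
  have hminus : ∀ i < 4, ∀ s ∈ Icc 0 h,
      HasDerivWithinAt (fun s => D i (x - s)) (-D (i + 1) (x - s)) (Icc 0 h) s := by
    intro i hi s hs
    have := (hderiv i hi (x - s) ⟨by linarith [hs.2], by linarith [hs.1]⟩).scomp s
      (((hasDerivAt_id s).const_sub x).hasDerivWithinAt (s := Icc 0 h))
      (fun r hr' => ⟨show a ≤ x - r by linarith [hr'.2], show x - r ≤ b by linarith [hr'.1]⟩)
    simpa [Function.comp_def] using this
  have b3 : ∀ s ∈ Icc 0 h, ‖D 3 (x + s) - D 3 (x - s)‖ ≤ 2 * B * h := by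
    refine norm_le_mul_of_hasDerivWithinAt (by positivity) (by simp)
      (fun s hs => (hplus 3 (by norm_num) s hs).sub (hminus 3 (by norm_num) s hs)) fun s hs => ?_
    have e1 := hB (x + s) ⟨by linarith [hs.1], by linarith [hs.2]⟩
    have e2 := hB (x - s) ⟨by linarith [hs.2], by linarith [hs.1]⟩
    rw [sub_neg_eq_add]
    exact (norm_add_le _ _).trans (by linarith)
  have b2 : ∀ s ∈ Icc 0 h, ‖D 2 (x + s) + D 2 (x - s) - 2 * D 2 x‖ ≤ 2 * B * h * h := by
    refine norm_le_mul_of_hasDerivWithinAt (by positivity) (by simp; ring)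
      (fun s hs => ((hplus 2 (by norm_num) s hs).add (hminus 2 (by norm_num) s hs)).sub_const _)
      fun s hs => ?_
    simpa [← sub_eq_add_neg] using b3 s hs
  have hid : ∀ s : ℝ, HasDerivWithinAt (fun s : ℝ => (s : ℂ)) 1 (Icc 0 h) s := fun s => by
    simpa using (hasDerivAt_id' s).ofReal_comp.hasDerivWithinAt (s := Icc 0 h)
  have b1 : ∀ s ∈ Icc 0 h, ‖D 1 (x + s) - D 1 (x - s) - s * (2 * D 2 x)‖ ≤ 2 * B * h * h * h := by
    refine norm_le_mul_of_hasDerivWithinAt (by positivity) (by simp)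
      (fun s hs => ((hplus 1 (by norm_num) s hs).sub (hminus 1 (by norm_num) s hs)).sub
        ((hid s).mul_const _)) fun s hs => ?_
    simpa using b2 s hs
  have b0 : ∀ s ∈ Icc 0 h, ‖D 0 (x + s) + D 0 (x - s) - 2 * D 0 x - s * s * D 2 x‖ ≤
      2 * B * h * h * h * h := by
    refine norm_le_mul_of_hasDerivWithinAt (by positivity) (by simp; ring)
      (fun s hs => (((hplus 0 (by norm_num) s hs).add (hminus 0 (by norm_num) s hs)).sub_const
        _).sub (((hid s).mul (hid s)).mul_const _)) fun s hs => ?_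
    convert! b1 s hs using 2
    simp
    ring
  have hfin := b0 h ⟨hh.le, le_rfl⟩
  have hh0 : (h : ℂ) ≠ 0 := by exact_mod_cast hh.ne'
  simp only [hD, iteratedDerivWithin_zero] at hfin
  rw [h2]
  have e : (g (x - h) - 2 * g x + g (x + h)) / (h : ℂ) ^ 2 - iteratedDerivWithin 2 g (Icc a b) x =
      (g (x + h) + g (x - h) - 2 * g x - h * h * iteratedDerivWithin 2 g (Icc a b) x) /
        (h : ℂ) ^ 2 := by
    field_simp
    ring
  rw [e, norm_div, norm_pow, Complex.norm_real, Real.norm_of_nonneg hh.le,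
    div_le_iff₀ (by positivity)]
  exact hfin.trans (le_of_eq (by ring))

/-! ### Consistency of the scheme in time -/

theorem continuous_weight (lam : ℝ) (p : ℂ) (u : ℝ) : Continuous (weight lam p u) := by
  unfold weight
  fun_prop

theorem norm_cexp_neg_mul_le_one {lam u t : ℝ} {p : ℂ} (hlam : 0 ≤ lam) (hp : 0 ≤ p.re)
    (hu : 0 ≤ u) (ht : 0 ≤ t) : ‖Complex.exp (-(((lam : ℂ) + p * (u : ℂ)) * (t : ℂ)))‖ ≤ 1 := by
  rw [Complex.norm_exp, Real.exp_le_one_iff]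
  simp only [Complex.neg_re, Complex.mul_re, Complex.add_re, Complex.ofReal_re, Complex.ofReal_im,
    mul_zero, sub_zero, Left.neg_nonpos_iff]
  positivity

/-- Multiplying the Grünwald estimate for the weighted function by the inverse weight, of modulus at
most 1, produces the tempered coefficients. The scheme subtracts `exp (-γ lam τ) lam^γ y` in place
of `lam^γ y`, a discrepancy of order `τ`. -/
theorem norm_temporal_truncation_le {γ lam T τ u C : ℝ} {p : ℂ} (h₀ : 0 < γ) (h₁ : γ < 1)
    (hlam : 0 ≤ lam) (hp : 0 ≤ p.re) (hu : 0 ≤ u) (hT : 0 < T) (hτ : 0 < τ) {y w : ℝ → ℂ}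
    (hy : ContinuousOn y (Icc 0 T)) (hy0 : y 0 = 0) (hw0 : ∀ t ≤ 0, w t = 0)
    (hwy : ∀ t ∈ Icc 0 T, w t = weight lam p u t * y t)
    (hw : w ∈ spectralClass (1 + γ)) (hC : spectralNorm (1 + γ) w ≤ C) {n : ℕ} (hn : n * τ ≤ T) :
    ‖∑ k ∈ Finset.range (n + 1), ((schemeCoeff γ lam τ k / τ ^ γ : ℝ) : ℂ) *
        (Complex.exp (-(p * (u : ℂ) * (k : ℂ) * (τ : ℂ))) * y (n * τ - k * τ)) -
      (temperedCaputo γ lam p u y (n * τ) - ((lam ^ γ : ℝ) : ℂ) * y (n * τ))‖ ≤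
      (10 + lam ^ γ * (γ * lam)) * C * τ := by
  have hv : ContinuousOn (fun t => weight lam p u t * y t) (Icc 0 T) :=
    (continuous_weight lam p u).continuousOn.mul hy
  have hv0 : weight lam p u 0 * y 0 = 0 := by rw [hy0, mul_zero]
  have hn0 : 0 ≤ (n : ℝ) * τ := by positivity
  have hcap := norm_grunwald_sub_caputo_le h₀ h₁ hT hτ hv hv0 hw0 hwy hw hC hn
  have hvC := norm_le_of_spectralNorm_le (by linarith) hT hv hv0 hw0 hwy hw hC (t := n * τ)
    ⟨hn0, hn⟩
  set e : ℂ := Complex.exp (-(((lam : ℂ) + p * (u : ℂ)) * ((n * τ : ℝ) : ℂ))) with he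
  have he1 : ‖e‖ ≤ 1 := norm_cexp_neg_mul_le_one hlam hp hu hn0
  -- The quotient of the weights at `t_n - t_k` and `t_n` is exactly the tempering and phase factor
  -- of the scheme.
  have hew : ∀ k : ℕ, e * weight lam p u (n * τ - k * τ) =
      (Real.exp (-(k * lam * τ)) : ℂ) * Complex.exp (-(p * (u : ℂ) * (k : ℂ) * (τ : ℂ))) := by
    intro k
    rw [he, weight, ← Complex.exp_add, Complex.ofReal_exp, ← Complex.exp_add]
    congr 1
    push_cast
    ring
  have hτγ : (τ ^ γ) ≠ 0 := (Real.rpow_pos_of_pos hτ γ).ne'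
  have hcoeff : ∀ k : ℕ, schemeCoeff γ lam τ k = temperedGrunwald γ lam τ k -
      if k = 0 then Real.exp (-(γ * lam * τ)) * (lam * τ) ^ γ else 0 := by
    intro k
    rw [schemeCoeff]
    split_ifs with hk
    · simp [hk, temperedGrunwald, grunwald_zero]
    · simp
  have hsum : ∑ k ∈ Finset.range (n + 1), ((schemeCoeff γ lam τ k / τ ^ γ : ℝ) : ℂ) *
        (Complex.exp (-(p * (u : ℂ) * (k : ℂ) * (τ : ℂ))) * y (n * τ - k * τ)) =
      e * (((τ ^ (-γ) : ℝ) : ℂ) * ∑ k ∈ Finset.range (n + 1), (grunwald γ k : ℂ) *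
        (weight lam p u (n * τ - k * τ) * y (n * τ - k * τ))) -
      ((Real.exp (-(γ * lam * τ)) * lam ^ γ : ℝ) : ℂ) * y (n * τ) := by
    have h1 : ((Real.exp (-(γ * lam * τ)) * lam ^ γ : ℝ) : ℂ) * y (n * τ) =
        ∑ k ∈ Finset.range (n + 1), if k = 0 then
          ((Real.exp (-(γ * lam * τ)) * lam ^ γ : ℝ) : ℂ) * y (n * τ) else 0 := by
      rw [Finset.sum_ite_eq' (Finset.range (n + 1)) 0]
      simp
    rw [h1, Finset.mul_sum, Finset.mul_sum, ← Finset.sum_sub_distrib]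
    refine Finset.sum_congr rfl fun k _ => ?_
    have h2 : e * (((τ ^ (-γ) : ℝ) : ℂ) * ((grunwald γ k : ℂ) *
        (weight lam p u (n * τ - k * τ) * y (n * τ - k * τ)))) =
        ((τ ^ (-γ) : ℝ) : ℂ) * (grunwald γ k : ℂ) *
          (e * weight lam p u (n * τ - k * τ)) * y (n * τ - k * τ) := by ring
    rw [h2, hew, hcoeff, temperedGrunwald, Real.rpow_neg hτ.le]
    split_ifs with hk
    · subst hk
      rw [Real.mul_rpow hlam hτ.le]
      have : (((τ ^ γ : ℝ)) : ℂ) ≠ 0 := by exact_mod_cast hτγ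
      simp only [Nat.cast_zero, zero_mul, sub_zero]
      generalize y (n * τ) = Y
      push_cast
      field_simp
      simp
      ring
    · push_cast
      ring
  have hfinal : e * (((τ ^ (-γ) : ℝ) : ℂ) * ∑ k ∈ Finset.range (n + 1), (grunwald γ k : ℂ) *
        (weight lam p u (n * τ - k * τ) * y (n * τ - k * τ))) -
      ((Real.exp (-(γ * lam * τ)) * lam ^ γ : ℝ) : ℂ) * y (n * τ) -
      (temperedCaputo γ lam p u y (n * τ) - ((lam ^ γ : ℝ) : ℂ) * y (n * τ)) =
      e * (((τ ^ (-γ) : ℝ) : ℂ) * ∑ k ∈ Finset.range (n + 1), (grunwald γ k : ℂ) *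
        (weight lam p u (n * τ - k * τ) * y (n * τ - k * τ)) -
          caputo γ (fun s => weight lam p u s * y s) (n * τ)) +
      ((lam ^ γ * (1 - Real.exp (-(γ * lam * τ))) : ℝ) : ℂ) *
        (e * (weight lam p u (n * τ) * y (n * τ))) := by
    have h3 : e * (weight lam p u (n * τ) * y (n * τ)) = y (n * τ) := by
      have := hew 0
      simp only [Nat.cast_zero, zero_mul, sub_zero, neg_zero, mul_zero, Real.exp_zero,
        Complex.exp_zero] at this
      rw [← mul_assoc, this]
      simp
    rw [h3, temperedCaputo, ← he]
    push_cast
    ring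
  rw [hsum, hfinal]
  have h4 : 0 ≤ 1 - Real.exp (-(γ * lam * τ)) := by
    rw [sub_nonneg, Real.exp_le_one_iff, Left.neg_nonpos_iff]
    positivity
  have h5 : 1 - Real.exp (-(γ * lam * τ)) ≤ γ * lam * τ := by
    linarith [Real.add_one_le_exp (-(γ * lam * τ))]
  have hlγ : 0 ≤ lam ^ γ := Real.rpow_nonneg hlam γ
  calc _ ≤ 1 * (10 * τ * C) + lam ^ γ * (γ * lam * τ) * (1 * C) := by
        refine (norm_add_le _ _).trans (add_le_add ?_ ?_)
        · rw [norm_mul]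
          exact mul_le_mul he1 hcap (norm_nonneg _) zero_le_one
        · rw [norm_mul, norm_mul, Complex.norm_real, Real.norm_of_nonneg (mul_nonneg hlγ h4)]
          exact mul_le_mul (mul_le_mul_of_nonneg_left h5 hlγ)
            (mul_le_mul he1 hvC (norm_nonneg _) zero_le_one) (by positivity) (by positivity)
    _ = _ := by ring

/-! ### Stability of the scheme -/

theorem sum_Icc_one_eq_sum_range {A : Type*} [AddCommMonoid A] (f : ℕ → A) (n : ℕ) :
    ∑ k ∈ Finset.Icc 1 n, f k = ∑ k ∈ Finset.range n, f (k + 1) := by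
  induction n with
  | zero => simp
  | succ n ih => rw [Finset.sum_Icc_succ_top (by omega), ih, Finset.sum_range_succ]

/-- Discrete Young inequality: exchange the order of summation, then enlarge the inner range. -/
theorem sum_convolution_le {c₀ : ℝ} {c : ℕ → ℝ} (hc : ∀ k, 0 ≤ c k)
    (hsum : ∀ n, ∑ k ∈ Finset.range n, c k ≤ c₀) {A : ℕ → ℝ} (hA : ∀ k, 0 ≤ A k) (N : ℕ) :
    ∑ n ∈ Finset.range N, ∑ k ∈ Finset.range (n + 1), c k * A (n - k) ≤
      c₀ * ∑ n ∈ Finset.range N, A n := by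
  rw [Finset.sum_range_diag_flip N (fun k j => c k * A j)]
  calc _ ≤ ∑ m ∈ Finset.range N, c m * ∑ n ∈ Finset.range N, A n := by
        refine Finset.sum_le_sum fun m _ => ?_
        rw [← Finset.mul_sum]
        refine mul_le_mul_of_nonneg_left (Finset.sum_le_sum_of_subset_of_nonneg ?_
          fun i _ _ => hA i) (hc m)
        exact Finset.range_subset_range.2 (Nat.sub_le _ _)
    _ ≤ _ := by
        rw [← Finset.sum_mul]
        exact mul_le_mul_of_nonneg_right (hsum N) (Finset.sum_nonneg fun i _ => hA i)

/-- Summation by parts, with the right boundary term kept so that the induction on `M` closes. -/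
theorem sum_conj_mul_second_difference {v : ℕ → ℂ} (h0 : v 0 = 0) (M : ℕ) :
    ∑ m ∈ Finset.range M, ((starRingEnd ℂ) (v (m + 1)) *
        (v m - 2 * v (m + 1) + v (m + 2))).re =
      ((starRingEnd ℂ) (v (M + 1)) * (v (M + 1) - v M)).re -
        ∑ m ∈ Finset.range (M + 1), ‖v (m + 1) - v m‖ ^ 2 := by
  have hn : ∀ z : ℂ, ‖z‖ ^ 2 = z.re ^ 2 + z.im ^ 2 := fun z => by
    rw [Complex.sq_norm, Complex.normSq_apply]
    ring
  induction M with
  | zero =>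
    simp [h0, hn]
    ring
  | succ M ih =>
    rw [Finset.sum_range_succ, ih, Finset.sum_range_succ (fun m => ‖v (m + 1) - v m‖ ^ 2) (M + 1),
      hn (v (M + 1 + 1) - v (M + 1))]
    simp
    ring

/-- Each history term is split by `2xy ≤ x² + y²`; the part with the current level is absorbed in
half of `c 0` by diagonal dominance. -/
theorem half_mul_sq_le_re_conj_mul_sum {c : ℕ → ℝ}
    (hc : ∀ n, ∑ k ∈ Finset.range n, |c (k + 1)| ≤ c 0) {θ : ℕ → ℂ} (hθ : ∀ k, ‖θ k‖ ≤ 1)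
    (hθ0 : θ 0 = 1) (e : ℕ → ℂ) (n : ℕ) :
    c 0 / 2 * ‖e (n + 1)‖ ^ 2 - 1 / 2 * ∑ k ∈ Finset.range (n + 1), |c (k + 1)| * ‖e (n - k)‖ ^ 2 ≤
      ((starRingEnd ℂ) (e (n + 1)) *
        ∑ k ∈ Finset.range (n + 1 + 1), (c k : ℂ) * (θ k * e (n + 1 - k))).re := by
  have h1 : ((starRingEnd ℂ) (e (n + 1)) * ((c 0 : ℂ) * (θ 0 * e (n + 1 - 0)))).re =
      c 0 * ‖e (n + 1)‖ ^ 2 := by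
    rw [hθ0, one_mul, Nat.sub_zero, mul_left_comm, Complex.re_ofReal_mul, mul_comm _ (e (n + 1)),
      Complex.mul_conj, Complex.ofReal_re, Complex.normSq_eq_norm_sq]
  have h2 : ∀ k, -(|c (k + 1)| * (1 / 2 * (‖e (n - k)‖ ^ 2 + ‖e (n + 1)‖ ^ 2))) ≤
      ((starRingEnd ℂ) (e (n + 1)) *
        ((c (k + 1) : ℂ) * (θ (k + 1) * e (n + 1 - (k + 1))))).re := by
    intro k
    rw [Nat.add_sub_add_right]
    refine le_trans ?_ (neg_le_of_abs_le (Complex.abs_re_le_norm _))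
    rw [neg_le_neg_iff, norm_mul, norm_mul, norm_mul, Complex.norm_real, Real.norm_eq_abs,
      Complex.norm_conj, mul_left_comm]
    refine mul_le_mul_of_nonneg_left ?_ (abs_nonneg _)
    calc ‖e (n + 1)‖ * (‖θ (k + 1)‖ * ‖e (n - k)‖) ≤ ‖e (n + 1)‖ * (1 * ‖e (n - k)‖) := by
          gcongr
          exact hθ _
      _ ≤ _ := by nlinarith [sq_nonneg (‖e (n + 1)‖ - ‖e (n - k)‖)]
  rw [Finset.sum_range_succ' (fun k => (c k : ℂ) * (θ k * e (n + 1 - k))), mul_add, Complex.add_re, h1,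
    Finset.mul_sum (Finset.range (n + 1)) (fun k => (c (k + 1) : ℂ) * _), Complex.re_sum]
  have h3 := Finset.sum_le_sum fun k (_ : k ∈ Finset.range (n + 1)) => h2 k
  have h4 : ∑ k ∈ Finset.range (n + 1),
      -(|c (k + 1)| * (1 / 2 * (‖e (n - k)‖ ^ 2 + ‖e (n + 1)‖ ^ 2))) =
      -(1 / 2 * ∑ k ∈ Finset.range (n + 1), |c (k + 1)| * ‖e (n - k)‖ ^ 2) -
      1 / 2 * (∑ k ∈ Finset.range (n + 1), |c (k + 1)|) * ‖e (n + 1)‖ ^ 2 := by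
    rw [Finset.mul_sum, Finset.mul_sum, Finset.sum_mul, ← Finset.sum_neg_distrib,
      ← Finset.sum_sub_distrib]
    exact Finset.sum_congr rfl fun k _ => by ring
  rw [h4] at h3
  have h5 := mul_le_mul_of_nonneg_right (hc (n + 1)) (sq_nonneg ‖e (n + 1)‖)
  linarith

/-- Test the equation with the conjugate error and sum over the grid. The convolution inequality
makes the time part nonnegative, leaving only the spatial energy and the source. -/
theorem energy_estimate {N M : ℕ} {κ : ℝ} {c : ℕ → ℝ}
    (hc : ∀ n, ∑ k ∈ Finset.range n, |c (k + 1)| ≤ c 0) {θ : ℕ → ℕ → ℂ}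
    (hθ : ∀ m < M, ∀ k, ‖θ (m + 1) k‖ ≤ 1) (hθ0 : ∀ m, θ m 0 = 1) {e R : ℕ → ℕ → ℂ}
    (heq : ∀ n < N, ∀ m < M,
      ∑ k ∈ Finset.range (n + 1 + 1), (c k : ℂ) * (θ (m + 1) k * e (n + 1 - k) (m + 1)) =
        (κ : ℂ) * (e (n + 1) m - 2 * e (n + 1) (m + 1) + e (n + 1) (m + 2)) + R (n + 1) (m + 1))
    (h0 : ∀ m < M, e 0 (m + 1) = 0) (hl : ∀ n < N, e (n + 1) 0 = 0)
    (hr : ∀ n < N, e (n + 1) (M + 1) = 0) :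
    κ * ∑ n ∈ Finset.range N, ∑ m ∈ Finset.range (M + 1), ‖e (n + 1) (m + 1) - e (n + 1) m‖ ^ 2 ≤
      ∑ n ∈ Finset.range N, ∑ m ∈ Finset.range M, ‖R (n + 1) (m + 1)‖ * ‖e (n + 1) (m + 1)‖ := by
  have hdiff : ∀ n < N, -∑ m ∈ Finset.range (M + 1), ‖e (n + 1) (m + 1) - e (n + 1) m‖ ^ 2 =
      ∑ m ∈ Finset.range M, ((starRingEnd ℂ) (e (n + 1) (m + 1)) *
        (e (n + 1) m - 2 * e (n + 1) (m + 1) + e (n + 1) (m + 2))).re := by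
    intro n hn
    rw [sum_conj_mul_second_difference (hl n hn) M, hr n hn]
    simp
  have hpt : ∀ n < N, ∀ m < M,
      c 0 / 2 * ‖e (n + 1) (m + 1)‖ ^ 2 -
        1 / 2 * ∑ k ∈ Finset.range (n + 1), |c (k + 1)| * ‖e (n - k) (m + 1)‖ ^ 2 ≤
      κ * ((starRingEnd ℂ) (e (n + 1) (m + 1)) *
        (e (n + 1) m - 2 * e (n + 1) (m + 1) + e (n + 1) (m + 2))).re +
        ‖R (n + 1) (m + 1)‖ * ‖e (n + 1) (m + 1)‖ := by
    intro n hn m hm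
    refine (half_mul_sq_le_re_conj_mul_sum hc (hθ m hm) (hθ0 (m + 1))
      (fun n => e n (m + 1)) n).trans ?_
    rw [heq n hn m hm, mul_add, Complex.add_re, mul_left_comm, Complex.re_ofReal_mul]
    gcongr
    refine (Complex.re_le_norm _).trans (le_of_eq ?_)
    rw [norm_mul, Complex.norm_conj, mul_comm]
  have hconv : ∀ m < M, 0 ≤ ∑ n ∈ Finset.range N, (c 0 / 2 * ‖e (n + 1) (m + 1)‖ ^ 2 -
        1 / 2 * ∑ k ∈ Finset.range (n + 1), |c (k + 1)| * ‖e (n - k) (m + 1)‖ ^ 2) := by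
    intro m hm
    have h1 := sum_convolution_le (fun k => abs_nonneg (c (k + 1))) hc
      (A := fun n => ‖e n (m + 1)‖ ^ 2) (fun k => sq_nonneg _) N
    -- The shift by one time level is free because the initial error is zero.
    have h2 : ∑ n ∈ Finset.range N, ‖e n (m + 1)‖ ^ 2 ≤
        ∑ n ∈ Finset.range N, ‖e (n + 1) (m + 1)‖ ^ 2 := by
      have h3 := Finset.sum_range_succ' (fun n => ‖e n (m + 1)‖ ^ 2) N
      have h4 := Finset.sum_range_succ (fun n => ‖e n (m + 1)‖ ^ 2) N
      rw [h0 m hm, norm_zero] at h3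
      have := sq_nonneg ‖e N (m + 1)‖
      linarith
    have hc0 : 0 ≤ c 0 := by simpa using hc 0
    have h5 := mul_le_mul_of_nonneg_left h2 hc0
    rw [Finset.sum_sub_distrib, ← Finset.mul_sum, ← Finset.mul_sum]
    linarith
  have htotal : 0 ≤ ∑ n ∈ Finset.range N, ∑ m ∈ Finset.range M,
      (κ * ((starRingEnd ℂ) (e (n + 1) (m + 1)) *
        (e (n + 1) m - 2 * e (n + 1) (m + 1) + e (n + 1) (m + 2))).re +
        ‖R (n + 1) (m + 1)‖ * ‖e (n + 1) (m + 1)‖) := by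
    rw [Finset.sum_comm]
    refine Finset.sum_nonneg fun m hm => (hconv m (Finset.mem_range.1 hm)).trans ?_
    exact Finset.sum_le_sum fun n hn => hpt n (Finset.mem_range.1 hn) m (Finset.mem_range.1 hm)
  have hsplit : ∑ n ∈ Finset.range N, ∑ m ∈ Finset.range M,
      (κ * ((starRingEnd ℂ) (e (n + 1) (m + 1)) *
        (e (n + 1) m - 2 * e (n + 1) (m + 1) + e (n + 1) (m + 2))).re +
        ‖R (n + 1) (m + 1)‖ * ‖e (n + 1) (m + 1)‖) =
      -(κ * ∑ n ∈ Finset.range N, ∑ m ∈ Finset.range (M + 1),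
        ‖e (n + 1) (m + 1) - e (n + 1) m‖ ^ 2) +
      ∑ n ∈ Finset.range N, ∑ m ∈ Finset.range M,
        ‖R (n + 1) (m + 1)‖ * ‖e (n + 1) (m + 1)‖ := by
    rw [Finset.mul_sum, ← Finset.sum_neg_distrib, ← Finset.sum_add_distrib]
    refine Finset.sum_congr rfl fun n hn => ?_
    rw [Finset.sum_add_distrib, ← Finset.mul_sum, ← hdiff n (Finset.mem_range.1 hn), mul_neg]
  linarith

/-- Telescoping from the zero left boundary value, then Cauchy-Schwarz; this is the discrete Sobolev
inequality. -/
theorem sq_norm_le_mul_sum_sq_norm_sub {v : ℕ → ℂ} (h0 : v 0 = 0) {m M : ℕ} (hm : m ≤ M) :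
    ‖v m‖ ^ 2 ≤ M * ∑ j ∈ Finset.range M, ‖v (j + 1) - v j‖ ^ 2 := by
  have h1 : ‖v m‖ ≤ ∑ j ∈ Finset.range M, ‖v (j + 1) - v j‖ := by
    have h2 := Finset.sum_range_sub v m
    rw [h0, sub_zero] at h2
    rw [← h2]
    refine (norm_sum_le _ _).trans (Finset.sum_le_sum_of_subset_of_nonneg ?_
      fun _ _ _ => norm_nonneg _)
    exact Finset.range_subset_range.2 hm
  have h3 := sq_sum_le_card_mul_sum_sq (s := Finset.range M) (f := fun j => ‖v (j + 1) - v j‖)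
  rw [Finset.card_range] at h3
  exact (pow_le_pow_left₀ (norm_nonneg _) h1 2).trans h3

/-! ### Discrete norms -/

theorem gridSeminormOne_nonneg (M : ℕ) (h : ℝ) (v : ℕ → ℂ) : 0 ≤ gridSeminormOne M h v :=
  Real.sqrt_nonneg _

theorem tripleNormOne_nonneg (N M : ℕ) (τ h : ℝ) (v : ℕ → ℕ → ℂ) :
    0 ≤ tripleNormOne N M τ h v :=
  Real.sqrt_nonneg _

theorem gridSeminormOne_sq {h : ℝ} (hh : 0 < h) (M : ℕ) (v : ℕ → ℂ) :
    gridSeminormOne M h v ^ 2 = (∑ m ∈ Finset.range M, ‖v (m + 1) - v m‖ ^ 2) / h := by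
  rw [gridSeminormOne, Real.sq_sqrt (by positivity), sum_Icc_one_eq_sum_range, Finset.sum_div,
    Finset.mul_sum]
  refine Finset.sum_congr rfl fun m _ => ?_
  rw [Nat.add_sub_cancel, norm_div, Complex.norm_real, Real.norm_of_nonneg hh.le]
  field_simp

theorem norm_le_sqrt_mul_gridSeminormOne {h : ℝ} (hh : 0 < h) {v : ℕ → ℂ} (h0 : v 0 = 0)
    {m M : ℕ} (hm : m ≤ M) : ‖v m‖ ≤ √(M * h) * gridSeminormOne M h v := by
  have h1 := sq_norm_le_mul_sum_sq_norm_sub h0 hm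
  refine abs_le_of_sq_le_sq' ?_ (mul_nonneg (Real.sqrt_nonneg _) (gridSeminormOne_nonneg _ _ _)) |>.2
  rw [mul_pow, Real.sq_sqrt (by positivity), gridSeminormOne_sq hh]
  refine h1.trans (le_of_eq ?_)
  field_simp

theorem gridMax_le_sqrt_mul_gridSeminormOne {h : ℝ} (hh : 0 < h) {v : ℕ → ℂ} (h0 : v 0 = 0)
    (M : ℕ) : gridMax M v ≤ √(M * h) * gridSeminormOne M h v := by
  have hB : 0 ≤ √(M * h) * gridSeminormOne M h v :=
    mul_nonneg (Real.sqrt_nonneg _) (Real.sqrt_nonneg _)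
  have : (Finset.Icc 1 (M - 1)).sup (fun m => ‖v m‖₊) ≤
      (⟨√(M * h) * gridSeminormOne M h v, hB⟩ : NNReal) := by
    refine Finset.sup_le fun m hm => ?_
    have hm' : m ≤ M := by
      have := (Finset.mem_Icc.1 hm).2
      omega
    exact norm_le_sqrt_mul_gridSeminormOne hh h0 hm'
  exact this

theorem tripleNormOne_sq {τ : ℝ} (hτ : 0 ≤ τ) (N M : ℕ) (h : ℝ) (v : ℕ → ℕ → ℂ) :
    tripleNormOne N M τ h v ^ 2 = τ * ∑ n ∈ Finset.range N, gridSeminormOne M h (v (n + 1)) ^ 2 := by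
  rw [tripleNormOne, Real.sq_sqrt (Finset.sum_nonneg fun n _ => by positivity),
    sum_Icc_one_eq_sum_range, Finset.mul_sum]
  exact Finset.sum_congr rfl fun n _ => mul_comm _ _

/-- The discrete Sobolev inequality at each time level, then Cauchy-Schwarz over the time levels. -/
theorem tripleNormMax_le {τ h : ℝ} (hτ : 0 ≤ τ) (hh : 0 < h) {N : ℕ} (M : ℕ) {v : ℕ → ℕ → ℂ}
    (h0 : ∀ n < N, v (n + 1) 0 = 0) :
    tripleNormMax N M τ v ≤ √(M * h) * √(N * τ) * tripleNormOne N M τ h v := by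
  have h1 : tripleNormMax N M τ v ≤
      √(M * h) * (τ * ∑ n ∈ Finset.range N, gridSeminormOne M h (v (n + 1))) := by
    rw [tripleNormMax, sum_Icc_one_eq_sum_range, Finset.mul_sum, Finset.mul_sum]
    refine Finset.sum_le_sum fun n hn => ?_
    have := mul_le_mul_of_nonneg_right
      (gridMax_le_sqrt_mul_gridSeminormOne hh (h0 n (Finset.mem_range.1 hn)) M) hτ
    linarith
  refine h1.trans ?_
  rw [mul_assoc]
  refine mul_le_mul_of_nonneg_left ?_ (Real.sqrt_nonneg _)
  refine abs_le_of_sq_le_sq' ?_ (mul_nonneg (Real.sqrt_nonneg _) (tripleNormOne_nonneg _ _ _ _ _)) |>.2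
  have h2 := sq_sum_le_card_mul_sum_sq (s := Finset.range N)
    (f := fun n => gridSeminormOne M h (v (n + 1)))
  rw [Finset.card_range] at h2
  rw [mul_pow, mul_pow, Real.sq_sqrt (by positivity), tripleNormOne_sq hτ]
  calc _ ≤ τ ^ 2 * (N * ∑ n ∈ Finset.range N, gridSeminormOne M h (v (n + 1)) ^ 2) := by gcongr
    _ = _ := by ring

/-- The discrete Sobolev inequality makes the source term linear in the seminorm, so Young's
inequality absorbs it in the quadratic left side. -/
theorem tripleNormOne_le_of_energy {N M : ℕ} {τ h K ρ : ℝ} (hτ : 0 < τ) (hh : 0 < h) (hK : 0 < K)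
    (hρ : 0 ≤ ρ) {e R : ℕ → ℕ → ℂ}
    (hR : ∀ n < N, ∀ m < M, ‖R (n + 1) (m + 1)‖ ≤ ρ) (h0 : ∀ n < N, e (n + 1) 0 = 0)
    (henergy : K / h ^ 2 *
      ∑ n ∈ Finset.range N, ∑ m ∈ Finset.range (M + 1), ‖e (n + 1) (m + 1) - e (n + 1) m‖ ^ 2 ≤
      ∑ n ∈ Finset.range N, ∑ m ∈ Finset.range M, ‖R (n + 1) (m + 1)‖ * ‖e (n + 1) (m + 1)‖) :
    tripleNormOne N (M + 1) τ h e ≤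
      √(N * τ) * √(((M + 1 : ℕ) : ℝ) * h) * (((M + 1 : ℕ) : ℝ) * h) / K * ρ := by
  set L : ℝ := ((M + 1 : ℕ) : ℝ) * h with hL
  have hL0 : 0 < L := by positivity
  set S : ℕ → ℝ := fun n => gridSeminormOne (M + 1) h (e (n + 1)) with hS
  have hS0 : ∀ n, 0 ≤ S n := fun n => Real.sqrt_nonneg _
  have h1 : K / h ^ 2 * ∑ n ∈ Finset.range N, ∑ m ∈ Finset.range (M + 1),
      ‖e (n + 1) (m + 1) - e (n + 1) m‖ ^ 2 = K / h * ∑ n ∈ Finset.range N, S n ^ 2 := by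
    simp only [hS, gridSeminormOne_sq hh]
    rw [← Finset.sum_div]
    field_simp
  have h2 : ∑ n ∈ Finset.range N, ∑ m ∈ Finset.range M, ‖R (n + 1) (m + 1)‖ * ‖e (n + 1) (m + 1)‖ ≤
      ∑ n ∈ Finset.range N, L / h * ρ * √L * S n := by
    refine Finset.sum_le_sum fun n hn => ?_
    have hn := Finset.mem_range.1 hn
    calc _ ≤ ∑ m ∈ Finset.range M, ρ * (√L * S n) := by
          refine Finset.sum_le_sum fun m hm => ?_
          have hm := Finset.mem_range.1 hm
          exact mul_le_mul (hR n hn m hm)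
            (norm_le_sqrt_mul_gridSeminormOne hh (h0 n hn) (by omega)) (norm_nonneg _) hρ
      _ = M * (ρ * (√L * S n)) := by rw [Finset.sum_const, Finset.card_range, nsmul_eq_mul]
      _ ≤ ((M + 1 : ℕ) : ℝ) * (ρ * (√L * S n)) := by
          refine mul_le_mul_of_nonneg_right (by push_cast; linarith) ?_
          exact mul_nonneg hρ (mul_nonneg (Real.sqrt_nonneg _) (hS0 n))
      _ = L / h * ρ * √L * S n := by
          rw [hL]
          field_simp
  have h3 : K * ∑ n ∈ Finset.range N, S n ^ 2 ≤ ∑ n ∈ Finset.range N, L * ρ * √L * S n := by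
    have h4 := mul_le_mul_of_nonneg_left ((h1.symm.le.trans henergy).trans h2) hh.le
    have h5 : h * (K / h * ∑ n ∈ Finset.range N, S n ^ 2) = K * ∑ n ∈ Finset.range N, S n ^ 2 := by
      field_simp
    have h6 : h * ∑ n ∈ Finset.range N, L / h * ρ * √L * S n =
        ∑ n ∈ Finset.range N, L * ρ * √L * S n := by
      rw [Finset.mul_sum]
      refine Finset.sum_congr rfl fun n _ => ?_
      field_simp
    rwa [h5, h6] at h4
  -- The Young weights are chosen so that the gap is the perfect square `(K S - L ρ √L)² / (2K)`.
  have h5 : ∀ n, L * ρ * √L * S n ≤ K / 2 * S n ^ 2 + L ^ 3 * ρ ^ 2 / (2 * K) := by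
    intro n
    have hsq : √L ^ 2 = L := Real.sq_sqrt hL0.le
    have h6 : K / 2 * S n ^ 2 + L ^ 3 * ρ ^ 2 / (2 * K) - L * ρ * √L * S n =
        (K * S n - L * ρ * √L) ^ 2 / (2 * K) := by
      field_simp
      linear_combination (-(L ^ 2 * ρ ^ 2)) * hsq
    have h7 : 0 ≤ (K * S n - L * ρ * √L) ^ 2 / (2 * K) := by positivity
    linarith
  have h8 : ∑ n ∈ Finset.range N, S n ^ 2 ≤ N * (L ^ 3 * ρ ^ 2 / K ^ 2) := by
    have h9 := h3.trans (Finset.sum_le_sum fun n _ => h5 n)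
    rw [Finset.sum_add_distrib, ← Finset.mul_sum, Finset.sum_const, Finset.card_range,
      nsmul_eq_mul] at h9
    have h10 : K / 2 * ∑ n ∈ Finset.range N, S n ^ 2 ≤
        K / 2 * (N * (L ^ 3 * ρ ^ 2 / K ^ 2)) := by
      have : K / 2 * (N * (L ^ 3 * ρ ^ 2 / K ^ 2)) = N * (L ^ 3 * ρ ^ 2 / (2 * K)) := by
        field_simp
      linarith
    exact le_of_mul_le_mul_left h10 (by positivity)
  refine abs_le_of_sq_le_sq' ?_ (by positivity) |>.2
  rw [tripleNormOne_sq hτ.le, mul_pow, div_pow, mul_pow, mul_pow, Real.sq_sqrt (by positivity),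
    Real.sq_sqrt hL0.le]
  calc _ ≤ τ * (N * (L ^ 3 * ρ ^ 2 / K ^ 2)) := mul_le_mul_of_nonneg_left h8 hτ.le
    _ = _ := by ring

/-! ### Truncation error and the final estimate -/

theorem norm_scheme_truncation_le {a b T γ lam K B C x τ h : ℝ} {p : ℂ} {U : ℝ → ℝ}
    {f G : ℝ → ℝ → ℂ} (hT : 0 < T) (h₀ : 0 < γ) (h₁ : γ < 1)
    (hlam : 0 ≤ lam) (hK : 0 < K) (hp : 0 ≤ p.re) (hU : ∀ x ∈ Icc a b, 0 ≤ U x)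
    (hG : IsSolution a b T γ lam K p U f G)
    (hG4 : ∀ t ∈ Icc 0 T, ContDiffOn ℝ 4 (fun x => G x t) (Icc a b))
    (hB : ∀ t ∈ Icc 0 T, ∀ x ∈ Icc a b,
      ‖iteratedDerivWithin 4 (fun y => G y t) (Icc a b) x‖ ≤ B)
    {w : ℝ → ℂ} (hw0 : ∀ t ≤ 0, w t = 0)
    (hwG : ∀ t ∈ Icc 0 T, w t = weight lam p (U x) t * G x t)
    (hw : w ∈ spectralClass (1 + γ)) (hC : spectralNorm (1 + γ) w ≤ C)
    (hτ : 0 < τ) (hh : 0 < h) (hl : a ≤ x - h) (hr : x + h ≤ b) {n : ℕ} (hn : 1 ≤ n)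
    (hnT : n * τ ≤ T) :
    ‖∑ k ∈ Finset.range (n + 1), ((schemeCoeff γ lam τ k / τ ^ γ : ℝ) : ℂ) *
        (Complex.exp (-(p * (U x : ℂ) * (k : ℂ) * (τ : ℂ))) * G x (n * τ - k * τ)) -
      (K * ((G (x - h) (n * τ) - 2 * G x (n * τ) + G (x + h) (n * τ)) / (h : ℂ) ^ 2) +
        f x (n * τ))‖ ≤
      ((10 + lam ^ γ * (γ * lam)) * |C| + 2 * K * |B|) * (τ + h ^ 2) := by
  have hx : x ∈ Ioo a b := ⟨by linarith, by linarith⟩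
  have hxI : x ∈ Icc a b := Ioo_subset_Icc_self hx
  have hn0 : 0 < (n : ℝ) * τ := by
    have : (0 : ℝ) < n := by exact_mod_cast hn
    positivity
  have ht : (n : ℝ) * τ ∈ Icc 0 T := ⟨hn0.le, hnT⟩
  have htime := norm_temporal_truncation_le h₀ h₁ hlam hp (hU x hxI) hT hτ
    (hG.contDiff_time x hxI).continuousOn (hG.initial x hxI) hw0 hwG hw (hC.trans (le_abs_self C))
    hnT
  have hspace := norm_central_difference_sub_le (hx.1.trans hx.2) hh (hG4 _ ht)
    (fun y hy => (hB _ ht y hy).trans (le_abs_self B)) hl hr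
  rw [hG.equation x hx _ ⟨hn0, hnT⟩] at htime
  set A := ∑ k ∈ Finset.range (n + 1), ((schemeCoeff γ lam τ k / τ ^ γ : ℝ) : ℂ) *
        (Complex.exp (-(p * (U x : ℂ) * (k : ℂ) * (τ : ℂ))) * G x (n * τ - k * τ))
  set Q := (G (x - h) (n * τ) - 2 * G x (n * τ) + G (x + h) (n * τ)) / (h : ℂ) ^ 2
  have hsplit : A - (K * Q + f x (n * τ)) =
      (A - (K * iteratedDeriv 2 (fun y => G y (n * τ)) x + f x (n * τ))) -
        K * (Q - iteratedDeriv 2 (fun y => G y (n * τ)) x) := by ring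
  rw [hsplit]
  have hlγ : 0 ≤ lam ^ γ := Real.rpow_nonneg hlam γ
  calc _ ≤ (10 + lam ^ γ * (γ * lam)) * |C| * τ + K * (2 * |B| * h ^ 2) := by
        refine (norm_sub_le _ _).trans (add_le_add htime ?_)
        rw [norm_mul, Complex.norm_real, Real.norm_of_nonneg hK.le]
        exact mul_le_mul_of_nonneg_left hspace hK.le
    _ ≤ _ := by
        have e1 : 0 ≤ (10 + lam ^ γ * (γ * lam)) * |C| * h ^ 2 := by positivity
        have e2 : 0 ≤ 2 * K * |B| * τ := by positivity
        linarith

theorem tripleNormOne_schemeError_le {a b T γ lam K B C : ℝ} {p : ℂ} {U : ℝ → ℝ}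
    {f G : ℝ → ℝ → ℂ} (hab : a < b) (hT : 0 < T) (h₀ : 0 < γ) (h₁ : γ < 1)
    (hlam : 0 ≤ lam) (hK : 0 < K) (hp : 0 ≤ p.re) (hU : ∀ x ∈ Icc a b, 0 ≤ U x)
    (hG : IsSolution a b T γ lam K p U f G)
    (hG4 : ∀ t ∈ Icc 0 T, ContDiffOn ℝ 4 (fun x => G x t) (Icc a b))
    (hB : ∀ t ∈ Icc 0 T, ∀ x ∈ Icc a b,
      ‖iteratedDerivWithin 4 (fun y => G y t) (Icc a b) x‖ ≤ B)
    (hC : ∀ x ∈ Ioo a b, ∃ w : ℝ → ℂ, (∀ t ≤ 0, w t = 0) ∧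
      (∀ t ∈ Icc 0 T, w t = weight lam p (U x) t * G x t) ∧
      w ∈ spectralClass (1 + γ) ∧ spectralNorm (1 + γ) w ≤ C)
    {N M : ℕ} {τ h : ℝ} {Gh : ℕ → ℕ → ℂ} (hN : 1 ≤ N)
    (hS : IsSchemeSolution a b T γ lam K p U f N (M + 1) τ h Gh) :
    tripleNormOne N (M + 1) τ h (schemeError a τ h G Gh) ≤
      √T * √(b - a) * (b - a) / K *
        (((10 + lam ^ γ * (γ * lam)) * |C| + 2 * K * |B|) * (τ + h ^ 2)) := by
  have hN0 : (0 : ℝ) < N := by exact_mod_cast hN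
  have hNτ : N * τ = T := by rw [hS.time_step]; field_simp
  have hMh : ((M + 1 : ℕ) : ℝ) * h = b - a := by rw [hS.space_step]; field_simp
  have hτ : 0 < τ := by rw [hS.time_step]; positivity
  have hh : 0 < h := by
    rw [hS.space_step]
    exact div_pos (by linarith) (by positivity)
  have hnT : ∀ n < N, ((n + 1 : ℕ) : ℝ) * τ ≤ T := fun n hn => by
    rw [← hNτ]
    gcongr
    omega
  have htm : ∀ n < N, ((n + 1 : ℕ) : ℝ) * τ ∈ Icc 0 T := fun n hn => ⟨by positivity, hnT n hn⟩
  have hend : a + ((M + 1 : ℕ) : ℝ) * h = b := by rw [hMh]; ring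
  have hxl : ∀ m : ℕ, a + ((m + 1 : ℕ) : ℝ) * h - h = a + (m : ℝ) * h := fun m => by
    push_cast
    ring
  have hxr : ∀ m : ℕ, a + ((m + 1 : ℕ) : ℝ) * h + h = a + ((m + 2 : ℕ) : ℝ) * h := fun m => by
    push_cast
    ring
  have hxl' : ∀ m : ℕ, a ≤ a + ((m + 1 : ℕ) : ℝ) * h - h := fun m => by
    rw [hxl]
    have : 0 ≤ (m : ℝ) * h := by positivity
    linarith
  have hxr' : ∀ m < M, a + ((m + 1 : ℕ) : ℝ) * h + h ≤ b := fun m hm => by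
    rw [hxr, ← hend]
    have h1 : ((m + 2 : ℕ) : ℝ) ≤ ((M + 1 : ℕ) : ℝ) := Nat.cast_le.2 (by omega)
    linarith [mul_le_mul_of_nonneg_right h1 hh.le]
  have hxI : ∀ m < M, a + ((m + 1 : ℕ) : ℝ) * h ∈ Ioo a b := fun m hm =>
    ⟨by linarith [hxl' m], by linarith [hxr' m hm]⟩
  set θ : ℕ → ℕ → ℂ := fun m k => Complex.exp (-(p * (U (a + m * h) : ℂ) * (k : ℂ) * (τ : ℂ)))
    with hθ
  -- `R` is the residual of the exact solution in the scheme; by linearity it is the source in the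
  -- equation for the error.
  set R : ℕ → ℕ → ℂ := fun n m =>
    ∑ k ∈ Finset.range (n + 1), ((schemeCoeff γ lam τ k / τ ^ γ : ℝ) : ℂ) *
        (θ m k * G (a + m * h) (n * τ - k * τ)) -
      (K * ((G (a + m * h - h) (n * τ) - 2 * G (a + m * h) (n * τ) + G (a + m * h + h) (n * τ)) /
        (h : ℂ) ^ 2) + f (a + m * h) (n * τ)) with hRdef
  have hR : ∀ n < N, ∀ m < M, ‖R (n + 1) (m + 1)‖ ≤
      ((10 + lam ^ γ * (γ * lam)) * |C| + 2 * K * |B|) * (τ + h ^ 2) := by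
    intro n hn m hm
    obtain ⟨w, hw0, hwG, hw, hwC⟩ := hC _ (hxI m hm)
    exact norm_scheme_truncation_le hT h₀ h₁ hlam hK hp hU hG hG4 hB hw0 hwG hw hwC hτ hh
      (hxl' m) (hxr' m hm) (Nat.le_add_left 1 n) (hnT n hn)
  have hleft : ∀ n < N, schemeError a τ h G Gh (n + 1) 0 = 0 := by
    intro n hn
    rw [schemeError, hS.left_boundary _ hn, Nat.cast_zero, zero_mul, add_zero,
      hG.left_boundary _ (htm n hn), sub_zero]
  have hτγ : 0 < τ ^ γ := Real.rpow_pos_of_pos hτ γ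
  have henergy := energy_estimate (N := N) (M := M) (κ := K / h ^ 2)
    (c := fun k => schemeCoeff γ lam τ k / τ ^ γ) (fun n => by
      simp only [abs_div, abs_of_pos hτγ]
      rw [← Finset.sum_div]
      exact div_le_div_of_nonneg_right (sum_abs_schemeCoeff_le h₀ h₁.le hlam hτ.le n) hτγ.le)
    (θ := θ) (fun m hm k => by
      have := norm_cexp_neg_mul_le_one le_rfl hp
        (hU _ (Ioo_subset_Icc_self (hxI m hm))) (t := k * τ) (by positivity)
      refine le_trans (le_of_eq ?_) this
      rw [hθ]
      push_cast
      congr 2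
      ring) (fun m => by simp [hθ])
    (e := schemeError a τ h G Gh) (R := R) (fun n hn m hm => by
      have heq := hS.equation (n + 1) (Finset.mem_Icc.2 ⟨by omega, hn⟩) (m + 1)
        (Finset.mem_Icc.2 ⟨by omega, by omega⟩)
      have hsum : ∑ k ∈ Finset.range (n + 1 + 1), ((schemeCoeff γ lam τ k / τ ^ γ : ℝ) : ℂ) *
            (θ (m + 1) k * schemeError a τ h G Gh (n + 1 - k) (m + 1)) =
          ∑ k ∈ Finset.range (n + 1 + 1), ((schemeCoeff γ lam τ k / τ ^ γ : ℝ) : ℂ) *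
            (θ (m + 1) k * G (a + (m + 1 : ℕ) * h) ((n + 1 : ℕ) * τ - k * τ)) -
          ∑ k ∈ Finset.range (n + 1 + 1), ((schemeCoeff γ lam τ k / τ ^ γ : ℝ) : ℂ) *
            (θ (m + 1) k * Gh (n + 1 - k) (m + 1)) := by
        rw [← Finset.sum_sub_distrib]
        refine Finset.sum_congr rfl fun k hk => ?_
        have hk' : k ≤ n + 1 := Nat.lt_succ_iff.1 (Finset.mem_range.1 hk)
        rw [schemeError, Nat.cast_sub hk', sub_mul]
        ring
      rw [hsum, heq, hRdef]
      simp only [schemeError]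
      rw [hxl, hxr, Nat.add_sub_cancel]
      push_cast
      ring)
    (fun m hm => by
      rw [schemeError, hS.initial _ (by omega), Nat.cast_zero, zero_mul,
        hG.initial _ (Ioo_subset_Icc_self (hxI m hm)), sub_zero])
    hleft
    (fun n hn => by
      rw [schemeError, hS.right_boundary _ hn, hend, hG.right_boundary _ (htm n hn), sub_zero])
  have hlγ : 0 ≤ lam ^ γ := Real.rpow_nonneg hlam γ
  have hfin := tripleNormOne_le_of_energy hτ hh hK (by positivity) hR hleft henergy
  rwa [hNτ, hMh] at hfin

end

end TemperedFeynmanKac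

theorem mainTheorem2 (a b T γ lam K : ℝ) (p : ℂ) (U : ℝ → ℝ) (f G : ℝ → ℝ → ℂ)
    (hab : a < b) (hT : 0 < T) (hγ₀ : 0 < γ) (hγ₁ : γ < 1) (hlam : 0 ≤ lam) (hK : 0 < K)
    (hp : 0 ≤ p.re) (hU : ∀ x ∈ Set.Icc a b, 0 ≤ U x)
    (hG : TemperedFeynmanKac.IsSolution a b T γ lam K p U f G)
    (hGx : TemperedFeynmanKac.SpaceRegular a b T G)
    (hGt : TemperedFeynmanKac.TimeRegular a b T γ lam p U G) :
    ∃ c₁ c₂ : ℝ, ∀ (N M : ℕ) (τ h : ℝ) (Gh : ℕ → ℕ → ℂ), 1 ≤ N → 1 ≤ M →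
      TemperedFeynmanKac.IsSchemeSolution a b T γ lam K p U f N M τ h Gh →
      TemperedFeynmanKac.tripleNormMax N M τ
          (TemperedFeynmanKac.schemeError a τ h G Gh) < c₁ * (τ + h ^ 2) ∧
      TemperedFeynmanKac.tripleNormOne N M τ h
          (TemperedFeynmanKac.schemeError a τ h G Gh) < c₂ * (τ + h ^ 2) := by
  obtain ⟨hG4, B, hB⟩ := hGx
  obtain ⟨C, hC⟩ := hGt
  set c : ℝ := √T * √(b - a) * (b - a) / K *
    ((10 + lam ^ γ * (γ * lam)) * |C| + 2 * K * |B|) with hc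
  -- The added 1 makes both inequalities strict, since `τ + h²` is positive.
  refine ⟨√(b - a) * √T * c + 1, c + 1, fun N M τ h Gh hN hM hS => ?_⟩
  obtain ⟨M, rfl⟩ : ∃ M', M = M' + 1 := ⟨M - 1, by omega⟩
  have hN0 : (0 : ℝ) < N := by exact_mod_cast hN
  have hNτ : N * τ = T := by rw [hS.time_step]; field_simp
  have hMh : ((M + 1 : ℕ) : ℝ) * h = b - a := by rw [hS.space_step]; field_simp
  have hτ : 0 < τ := by rw [hS.time_step]; positivity
  have hh : 0 < h := by
    rw [hS.space_step]
    exact div_pos (by linarith) (by positivity)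
  have hpos : 0 < τ + h ^ 2 := by positivity
  have hone : TemperedFeynmanKac.tripleNormOne N (M + 1) τ h
      (TemperedFeynmanKac.schemeError a τ h G Gh) ≤ c * (τ + h ^ 2) := by
    rw [hc, mul_assoc]
    exact TemperedFeynmanKac.tripleNormOne_schemeError_le hab hT hγ₀ hγ₁ hlam hK hp hU hG hG4 hB
      hC hN hS
  have hmax := TemperedFeynmanKac.tripleNormMax_le hτ.le hh (N := N) (M + 1)
    (v := TemperedFeynmanKac.schemeError a τ h G Gh) (fun n hn => by
      have hn' : ((n + 1 : ℕ) : ℝ) * τ ≤ T := by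
        rw [← hNτ]
        gcongr
        omega
      rw [TemperedFeynmanKac.schemeError, hS.left_boundary _ hn, Nat.cast_zero, zero_mul, add_zero,
        hG.left_boundary _ ⟨by positivity, hn'⟩, sub_zero])
  rw [hNτ, hMh] at hmax
  have hmul := mul_le_mul_of_nonneg_left hone
    (mul_nonneg (Real.sqrt_nonneg (b - a)) (Real.sqrt_nonneg T))
  exact ⟨by linarith, by linarith⟩
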